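/- Let $N\ge 0$ be an integer, let $\varepsilon_1,\varepsilon_2,\rho_2,\alpha_2\in\mathbb R$ and $p_i,\xi_{i0},C_i\in\mathbb C$ ($1\le i\le N$) be such that $p_i+p_j^*\neq 0$ and $\dfrac{\varepsilon_2\rho_2^2}{(p_i-\mathrm i\alpha_2)(p_j^*+\mathrm i\alpha_2)}\neq 1$ for all $i,j$ (so that all denominators below are nonzero; ${}^*$ is complex conjugation). For $x,t\in\mathbb R$ put $$\xi_i=p_i(x-3\varepsilon_2\rho_2^2t)+p_i^3t+\xi_{i0},\qquad \Phi=(e^{\xi_1},\dots,e^{\xi_N})^T,\qquad \Psi=(C_1,\dots,C_N)^T,$$ let $M_k=(m^k_{ij})$ be the $N\times N$ matrix with entries $$m^k_{ij}=\frac1{p_i+p_j^*}\left(-\frac{p_i-\mathrm i\alpha_2}{p_j^*+\mathrm i\alpha_2}\right)^k e^{\xi_i+\xi_j^*}+\frac{\varepsilon_1C_i^*C_j}{(p_i+p_j^*)\left(\frac{\varepsilon_2\rho_2^2}{(p_i-\mathrm i\alpha_2)(p_j^*+\mathrm i\alpha_2)}-1\right)},$$ and put $$f=\det M_0,\qquad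 h_2=\det M_1,\qquad g_1=\det\begin{pmatrix}M_0&\Phi\\-\Psi^T&0\end{pmatrix},$$ $$u_1=\frac{g_1}{f}\,e^{-3\mathrm i\rho_2^2\varepsilon_2\alpha_2t},\qquad u_2=\rho_2\frac{h_2}{f}\,e^{\mathrm i\left(\alpha_2x-(\alpha_2^3+6\varepsilon_2\alpha_2\rho_2^2)t\right)}.$$ Then: (1) The set $\{(x,t)\in\mathbb R^2: f(x,t)\ne0\}$ is open, $u_1,u_2$ are $C^\infty$ on it, and there they solve the coupled Hirota system $$u_{k,t}=u_{k,xxx}-3\left(\varepsilon_1|u_1|^2+\varepsilon_2|u_2|^2\right)u_{k,x}-3u_k\left(\varepsilon_1u_1^*u_{1,x}+\varepsilon_2u_2^*u_{2,x}\right),\qquad k=1,2.$$ (2) (Bright-dark boundary behaviour.) If moreover $\varepsilon_1\ne0$, the $p_i$ are pairwise distinct, and $(p_i-\mathrm i\alpha_2)(p_j-\mathrm i\alpha_2)\ne-\varepsilon_2\rho_2^2$ whenever $i\ne j$ and $C_i,C_j\neq0$, then for every $t\in\mathbb R$ one has $u_1\to0$ and $|u_2|\to|\rho_2|$ as $x\to\pm\infty$.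 -/

import Mathlib

open scoped ComplexConjugate Topology ContDiff

noncomputable section

namespace CoupledHirota

/-- The right-hand side, at `(x, t)`, of the equation for the component `v` of the coupled Hirota
system, namely
`v_xxx - 3 (ε₁ |u₁|² + ε₂ |u₂|²) v_x - 3 v (ε₁ u₁^* u₁_x + ε₂ u₂^* u₂_x)`;
it is used with `v = u₁` and with `v = u₂`. -/
def rhs (ε₁ ε₂ : ℝ) (u₁ u₂ v : ℝ → ℝ → ℂ) (x t : ℝ) : ℂ :=
  iteratedDeriv 3 (fun y => v y t) x
    - 3 * ((ε₁ : ℂ) * (‖u₁ x t‖ : ℂ) ^ 2 + (ε₂ : ℂ) * (‖u₂ x t‖ : ℂ) ^ 2)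
        * deriv (fun y => v y t) x
    - 3 * v x t * ((ε₁ : ℂ) * conj (u₁ x t) * deriv (fun y => u₁ y t) x
        + (ε₂ : ℂ) * conj (u₂ x t) * deriv (fun y => u₂ y t) x)

/-- `(u₁, u₂)` is a smooth classical solution of the coupled Hirota system on the open set `Ω` of
the `(x, t)`-plane. Smoothness (over the reals, jointly in `(x, t)`) is part of the notion. -/
structure IsSolutionOn (ε₁ ε₂ : ℝ) (Ω : Set (ℝ × ℝ)) (u₁ u₂ : ℝ → ℝ → ℂ) : Prop where
  isOpen : IsOpen Ω
  smooth₁ : ContDiffOn ℝ ∞ (fun z : ℝ × ℝ => u₁ z.1 z.2) Ω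
  smooth₂ : ContDiffOn ℝ ∞ (fun z : ℝ × ℝ => u₂ z.1 z.2) Ω
  eq₁ : ∀ x t : ℝ, (x, t) ∈ Ω → deriv (fun s => u₁ x s) t = rhs ε₁ ε₂ u₁ u₂ u₁ x t
  eq₂ : ∀ x t : ℝ, (x, t) ∈ Ω → deriv (fun s => u₂ x s) t = rhs ε₁ ε₂ u₁ u₂ u₂ x t

/-- The mixed (bright-dark) boundary condition: at every time, `u₁ → 0` and `|u₂| → |ρ|` as
`x → ±∞`. -/
def MixedBoundary (ρ : ℝ) (u₁ u₂ : ℝ → ℝ → ℂ) : Prop :=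
  ∀ t : ℝ,
    Filter.Tendsto (fun x => u₁ x t) Filter.atTop (𝓝 0) ∧
    Filter.Tendsto (fun x => u₁ x t) Filter.atBot (𝓝 0) ∧
    Filter.Tendsto (fun x => ‖u₂ x t‖) Filter.atTop (𝓝 |ρ|) ∧
    Filter.Tendsto (fun x => ‖u₂ x t‖) Filter.atBot (𝓝 |ρ|)

section BrightDark

variable {N : ℕ} (ε₁ ε₂ ρ₂ α₂ : ℝ) (p ξ₀ C : Fin N → ℂ)

/-- The phases `ξᵢ = pᵢ (x - 3 ε₂ ρ₂² t) + pᵢ³ t + ξᵢ₀`. -/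
def phase (x t : ℝ) (i : Fin N) : ℂ :=
  p i * ((x : ℂ) - 3 * (ε₂ : ℂ) * (ρ₂ : ℂ) ^ 2 * (t : ℂ)) + p i ^ 3 * (t : ℂ) + ξ₀ i

/-- The `N × N` matrix `M_k`. -/
def matM (k : ℤ) (x t : ℝ) : Matrix (Fin N) (Fin N) ℂ :=
  Matrix.of fun i j =>
    1 / (p i + conj (p j))
        * (-((p i - Complex.I * (α₂ : ℂ)) / (conj (p j) + Complex.I * (α₂ : ℂ)))) ^ k
        * Complex.exp (phase ε₂ ρ₂ p ξ₀ x t i + conj (phase ε₂ ρ₂ p ξ₀ x t j))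
      + (ε₁ : ℂ) * conj (C i) * C j
        / ((p i + conj (p j))
          * ((ε₂ : ℂ) * (ρ₂ : ℂ) ^ 2
              / ((p i - Complex.I * (α₂ : ℂ)) * (conj (p j) + Complex.I * (α₂ : ℂ))) - 1))

/-- `f = |M_0|`. -/
def tauF (x t : ℝ) : ℂ := (matM ε₁ ε₂ ρ₂ α₂ p ξ₀ C 0 x t).det

/-- `h₂ = |M_1|`. -/
def tauH (x t : ℝ) : ℂ := (matM ε₁ ε₂ ρ₂ α₂ p ξ₀ C 1 x t).det

/-- `g₁`, the determinant of `M_0` bordered by the column `(e^{ξᵢ})`, the row `(-Cⱼ)` and the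
corner `0`. -/
def tauG (x t : ℝ) : ℂ :=
  (Matrix.fromBlocks (matM ε₁ ε₂ ρ₂ α₂ p ξ₀ C 0 x t)
    (Matrix.of fun i (_ : Unit) => Complex.exp (phase ε₂ ρ₂ p ξ₀ x t i))
    (Matrix.of fun (_ : Unit) j => -C j)
    (0 : Matrix Unit Unit ℂ)).det

/-- The bright component `u₁`. -/
def bright (x t : ℝ) : ℂ :=
  tauG ε₁ ε₂ ρ₂ α₂ p ξ₀ C x t / tauF ε₁ ε₂ ρ₂ α₂ p ξ₀ C x t
    * Complex.exp (-3 * Complex.I * (ρ₂ : ℂ) ^ 2 * (ε₂ : ℂ) * (α₂ : ℂ) * (t : ℂ))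

/-- The dark component `u₂`. -/
def dark (x t : ℝ) : ℂ :=
  tauH ε₁ ε₂ ρ₂ α₂ p ξ₀ C x t / tauF ε₁ ε₂ ρ₂ α₂ p ξ₀ C x t * (ρ₂ : ℂ)
    * Complex.exp (Complex.I * ((α₂ : ℂ) * (x : ℂ)
        - ((α₂ : ℂ) ^ 3 + 6 * (ε₂ : ℂ) * (α₂ : ℂ) * (ρ₂ : ℂ) ^ 2) * (t : ℂ)))

end BrightDark

end CoupledHirota

end

/-!
Write `d = p - i α₂`, `κ = ε₂ ρ₂²`, `Φ = (e^{ξᵢ})` and `K = M₀⁻¹`. Everything is expressed through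
the scalars `r K c` (`bracket`) for a few rows `r` and columns `c`: the potentials
`T_{jk} = Φ† (P^*)ʲ K Pᵏ Φ`, `R_k = Ψᵀ K Pᵏ Φ` and `W_k = Φ† (P^* + i α₂)⁻¹ K Pᵏ Φ`. The bordered
determinant gives `g₁ / f = R_0`, and since `M₁ - M₀` has rank one, `h₂ / f = 1 - W_0`.

The linear half of the argument is that `∂ₓ M₀ = Φ Φ†`, while `∂ₜ M₀` is a combination of the
rank-one matrices `P²ΦΦ†`, `PΦΦ†P^*`, `ΦΦ†P^*²`, `ΦΦ†`. Therefore `R_k` and `(i α₂)ᵏ - W_k`,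
multiplied by the elementary exponentials, both satisfy `Y_k' = Y_{k+1} - Y_0 T_{0k}` together with
one and the same formula for `∂ₜ Y_0` (`hasDerivAt_brightSeq_x`, `hasDerivAt_darkSeq_x` and their
`t`-versions).
Eliminating the `Y_k` with `k > 0` shows that `u₁` and `u₂` solve one linear third-order equation
whose coefficients are polynomials in the `T_{jk}` (`derivs_of_recursion`).

The nonlinear half identifies these coefficients. With `Λ = diag (κ / d - d)` the matrix
`Λ M₀ + M₀ Λ^*` is a sum of three rank-one matrices (`matM_sylvester`). Multiplying by `K` on both
sides and pairing with `Φ†` and with `Φ` or `P Φ` yields exactly the expressions for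
`ε₁ |u₁|² + ε₂ |u₂|²` and `ε₁ u₁^* u₁_x + ε₂ u₂^* u₂_x` in terms of the `T_{jk}`
(`intensity_identity`, `current_identity`).

For the boundary behaviour one divides the rows and columns of all the matrices by `e^{ξᵢ}` and
`e^{ξᵢ^*}` for those `i` whose exponential blows up or for which `Cᵢ = 0`. The rescaled `M_k`
converge to block diagonal matrices. For `k = 0` both blocks are, up to diagonal factors, Cauchy
matrices, with the nodes `pᵢ` and `κ / dᵢ - dᵢ`; they are invertible because the nodes are distinct,
which is what the nondegeneracy assumptions say. In the limit the bordered determinant vanishes by a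
change of signs (`det_borderedGram_eq_zero`), and the determinants for `k = 0` and `k = 1` differ by
a factor of modulus one (`norm_det_gram_one`).
-/

namespace CoupledHirota

open Matrix

/-! ### Brackets with an inverse matrix -/

section Bracket
variable {n : Type*} [Fintype n] [DecidableEq n]

/-- The scalar `r M⁻¹ c` attached to a row `r` and a column `c`. It is `0` for singular `M`, where
`M⁻¹ = 0`. -/
noncomputable def bracket (M : Matrix n n ℂ) (r c : n → ℂ) : ℂ := r ⬝ᵥ (M⁻¹ *ᵥ c)

lemma bracket_add_left (M : Matrix n n ℂ) (r s c : n → ℂ) :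
    bracket M (r + s) c = bracket M r c + bracket M s c := by
  simp [bracket, add_dotProduct]

lemma bracket_smul_left (M : Matrix n n ℂ) (z : ℂ) (r c : n → ℂ) :
    bracket M (z • r) c = z * bracket M r c := by
  simp [bracket]

lemma bracket_add_right (M : Matrix n n ℂ) (r c d : n → ℂ) :
    bracket M r (c + d) = bracket M r c + bracket M r d := by
  simp [bracket, mulVec_add, dotProduct_add]

lemma bracket_smul_right (M : Matrix n n ℂ) (z : ℂ) (r c : n → ℂ) :
    bracket M r (z • c) = z * bracket M r c := by
  simp [bracket, mulVec_smul]

/-- A rank-one matrix between two inverses splits the bracket. -/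
lemma dotProduct_inv_vecMulVec_inv (M : Matrix n n ℂ) (r c u v : n → ℂ) :
    r ⬝ᵥ ((M⁻¹ * vecMulVec u v * M⁻¹) *ᵥ c) = bracket M r u * bracket M v c := by
  simp only [bracket, ← mulVec_mulVec, vecMulVec_mulVec, mulVec_smul]
  simp [mul_comm]

lemma conj_bracket {M : Matrix n n ℂ} (hM : M.IsHermitian) (r c : n → ℂ) :
    conj (bracket M r c) = bracket M (star c) (star r) := by
  have h : star (M⁻¹ *ᵥ c) = star c ᵥ* M⁻¹ := by
    rw [star_mulVec, hM.inv.eq]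
  rw [bracket, starRingEnd_apply, ← star_dotProduct_star, h, bracket, dotProduct_mulVec]

lemma hasDerivAt_matrix_inv {M : ℝ → Matrix n n ℂ} {M' : Matrix n n ℂ} {x : ℝ}
    (h : ∀ i j, HasDerivAt (fun s => M s i j) (M' i j) x) (hdet : (M x).det ≠ 0) (i j : n) :
    HasDerivAt (fun s => (M s)⁻¹ i j) (-((M x)⁻¹ * M' * (M x)⁻¹) i j) x := by
  let : NormedRing (Matrix n n ℂ) := Matrix.linftyOpNormedRing
  let : NormedAlgebra ℝ (Matrix n n ℂ) := Matrix.linftyOpNormedAlgebra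
  have hM : HasDerivAt M M' x := hasDerivAt_pi.2 fun i => hasDerivAt_pi.2 fun j => h i j
  have hu : IsUnit (M x) := (Matrix.isUnit_iff_isUnit_det _).2 hdet.isUnit
  obtain ⟨u, hu⟩ := hu
  have h1 := hasFDerivAt_ringInverse (𝕜 := ℝ) u
  rw [hu] at h1
  have h2 := h1.comp_hasDerivAt x hM
  have h3 := hasDerivAt_pi.1 (hasDerivAt_pi.1 h2 i) j
  have hinv : (↑u⁻¹ : Matrix n n ℂ) = (M x)⁻¹ := by rw [← hu, Matrix.coe_units_inv]
  simpa [Function.comp_def, ← Matrix.nonsing_inv_eq_ringInverse, hinv] using h3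

lemma hasDerivAt_bracket {M : ℝ → Matrix n n ℂ} {M' : Matrix n n ℂ} {r c : ℝ → n → ℂ}
    {r' c' : n → ℂ} {x : ℝ}
    (h : ∀ i j, HasDerivAt (fun s => M s i j) (M' i j) x) (hdet : (M x).det ≠ 0)
    (hr : ∀ i, HasDerivAt (fun s => r s i) (r' i) x)
    (hc : ∀ i, HasDerivAt (fun s => c s i) (c' i) x) :
    HasDerivAt (fun s => bracket (M s) (r s) (c s))
      (bracket (M x) r' (c x) + bracket (M x) (r x) c'
        - r x ⬝ᵥ (((M x)⁻¹ * M' * (M x)⁻¹) *ᵥ c x)) x := by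
  have key : HasDerivAt (fun s => ∑ i, r s i * ∑ j, (M s)⁻¹ i j * c s j)
      (∑ i, (r' i * (∑ j, (M x)⁻¹ i j * c x j) + r x i *
        ∑ j, (-((M x)⁻¹ * M' * (M x)⁻¹) i j * c x j + (M x)⁻¹ i j * c' j))) x :=
    HasDerivAt.fun_sum fun i _ => (hr i).mul
      (HasDerivAt.fun_sum fun j _ => (hasDerivAt_matrix_inv h hdet i j).mul (hc j))
  refine key.congr_deriv ?_
  simp only [bracket, dotProduct, mulVec, Finset.sum_add_distrib, mul_add, neg_mul,
    Finset.sum_neg_distrib, mul_neg]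
  ring

/-- A matrix identity `Λ M + M Λ' = ∑ rank one`, with `Λ` and `Λ'` diagonal, multiplied on both
sides by `M⁻¹`. -/
lemma bracket_sylvester {M : Matrix n n ℂ} (hdet : M.det ≠ 0) {l m u v f g b c : n → ℂ} {κ ε : ℂ}
    (h : ∀ i j, l i * M i j + M i j * m j = κ * (u i * v j) - f i * g j + ε * (b i * c j))
    (r z : n → ℂ) :
    bracket M r (l * z) + bracket M (r * m) z =
      κ * (bracket M r u * bracket M v z) - bracket M r f * bracket M g z
        + ε * (bracket M r b * bracket M c z) := by
  have hU : IsUnit M.det := hdet.isUnit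
  have hmat : diagonal l * M + M * diagonal m
      = κ • vecMulVec u v - vecMulVec f g + ε • vecMulVec b c := by
    ext i j
    simpa [vecMulVec_apply] using h i j
  have h2 : M⁻¹ * diagonal l + diagonal m * M⁻¹ =
      κ • (M⁻¹ * vecMulVec u v * M⁻¹) - M⁻¹ * vecMulVec f g * M⁻¹
        + ε • (M⁻¹ * vecMulVec b c * M⁻¹) := by
    have := congrArg (fun X => M⁻¹ * X * M⁻¹) hmat
    simp only [mul_add, add_mul, mul_sub, sub_mul, Matrix.mul_smul, Matrix.smul_mul] at this
    rw [← this, ← Matrix.mul_assoc, Matrix.mul_nonsing_inv_cancel_right _ _ hU,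
      Matrix.nonsing_inv_mul_cancel_left _ _ hU]
  have h3 := congrArg (fun X => r ⬝ᵥ (X *ᵥ z)) h2
  simp only [add_mulVec, sub_mulVec, smul_mulVec, dotProduct_add, dotProduct_sub, dotProduct_smul,
    dotProduct_inv_vecMulVec_inv, smul_eq_mul] at h3
  rw [← h3]
  congr 1
  · rw [bracket, ← mulVec_mulVec]
    congr 2
    ext i
    simp [mulVec_diagonal]
  · rw [bracket, ← mulVec_mulVec]
    simp [dotProduct, mulVec_diagonal, mul_assoc]

lemma det_bordered {M : Matrix n n ℂ} (hdet : M.det ≠ 0) (c r : n → ℂ) :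
    (Matrix.fromBlocks M (Matrix.of fun i (_ : Unit) => c i) (Matrix.of fun (_ : Unit) j => -r j)
      (0 : Matrix Unit Unit ℂ)).det = M.det * bracket M r c := by
  let := M.invertibleOfIsUnitDet hdet.isUnit
  rw [det_fromBlocks₁₁, invOf_eq_nonsing_inv]
  congr 1
  rw [det_unique]
  simp only [Matrix.mul_assoc, zero_sub, Matrix.neg_apply]
  rw [Matrix.mul_apply]
  simp [bracket, dotProduct, mulVec, Matrix.mul_apply]

lemma det_sub_vecMulVec {M : Matrix n n ℂ} (hdet : M.det ≠ 0) (c r : n → ℂ) :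
    (M - vecMulVec c r).det = M.det * (1 - bracket M r c) := by
  have h := det_add_replicateCol_mul_replicateRow (ι := Unit) hdet.isUnit (-c) r
  have h1 : M + replicateCol Unit (-c) * replicateRow Unit r = M - vecMulVec c r := by
    ext i j; simp [Matrix.mul_apply, vecMulVec_apply, sub_eq_add_neg]
  rw [← h1, h]
  congr 1
  rw [det_unique]
  simp only [Matrix.mul_assoc, Matrix.add_apply]
  rw [Matrix.mul_apply]
  simp [bracket, dotProduct, mulVec, Matrix.mul_apply, sub_eq_add_neg]

lemma contDiff_det {E : Type*} [NormedAddCommGroup E] [NormedSpace ℝ E] {M : E → Matrix n n ℂ}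
    (h : ∀ i j, ContDiff ℝ ∞ fun z => M z i j) : ContDiff ℝ ∞ fun z => (M z).det := by
  simp only [Matrix.det_apply]
  exact ContDiff.sum fun σ _ => (contDiff_prod fun i _ => h _ _).const_smul _

end Bracket

/-! ### The potentials and their derivatives -/

section Data
variable {N : ℕ} (ε₁ ε₂ ρ₂ α₂ : ℝ) (p ξ₀ C : Fin N → ℂ)

/-- The column `(pᵢᵏ e^{ξᵢ})`. -/
noncomputable def col (k : ℕ) (x t : ℝ) : Fin N → ℂ :=
  fun i => p i ^ k * Complex.exp (phase ε₂ ρ₂ p ξ₀ x t i)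

/-- The row `((pⱼ^*)ᵏ e^{ξⱼ^*})`. -/
noncomputable def row (k : ℕ) (x t : ℝ) : Fin N → ℂ :=
  fun j => conj (p j) ^ k * conj (Complex.exp (phase ε₂ ρ₂ p ξ₀ x t j))

/-- The row `(e^{ξⱼ^*} / (pⱼ^* + i α₂))`. -/
noncomputable def darkRow (x t : ℝ) : Fin N → ℂ :=
  fun j => conj (Complex.exp (phase ε₂ ρ₂ p ξ₀ x t j)) / (conj (p j) + Complex.I * α₂)

/-- The potentials `T_{jk} = Φ† (P^*)ʲ M₀⁻¹ Pᵏ Φ`, with `P = diag pᵢ`. -/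
noncomputable def potT (j k : ℕ) (x t : ℝ) : ℂ :=
  bracket (matM ε₁ ε₂ ρ₂ α₂ p ξ₀ C 0 x t) (row ε₂ ρ₂ p ξ₀ j x t) (col ε₂ ρ₂ p ξ₀ k x t)

/-- The potentials `R_k = Ψᵀ M₀⁻¹ Pᵏ Φ`. -/
noncomputable def potR (k : ℕ) (x t : ℝ) : ℂ :=
  bracket (matM ε₁ ε₂ ρ₂ α₂ p ξ₀ C 0 x t) C (col ε₂ ρ₂ p ξ₀ k x t)

/-- The potentials `W_k = Φ† (P^* + i α₂)⁻¹ M₀⁻¹ Pᵏ Φ`. -/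
noncomputable def potW (k : ℕ) (x t : ℝ) : ℂ :=
  bracket (matM ε₁ ε₂ ρ₂ α₂ p ξ₀ C 0 x t) (darkRow ε₂ ρ₂ α₂ p ξ₀ x t) (col ε₂ ρ₂ p ξ₀ k x t)

variable {p}

lemma sub_ne_zero_of_add_conj (hp : ∀ i j, p i + conj (p j) ≠ 0) (i : Fin N) :
    p i - Complex.I * α₂ ≠ 0 := by
  intro h
  apply hp i i
  rw [sub_eq_zero.1 h]
  simp

lemma conj_sub_I_mul (z : ℂ) : conj (z - Complex.I * α₂) = conj z + Complex.I * α₂ := by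
  simp

lemma conj_add_ne_zero (hp : ∀ i j, p i + conj (p j) ≠ 0) (i : Fin N) :
    conj (p i) + Complex.I * α₂ ≠ 0 := by
  rw [← conj_sub_I_mul]
  exact (map_ne_zero _).2 (sub_ne_zero_of_add_conj α₂ hp i)

variable (p)

lemma hasDerivAt_phase_x (x t : ℝ) (i : Fin N) :
    HasDerivAt (fun y : ℝ => phase ε₂ ρ₂ p ξ₀ y t i) (p i) x := by
  have h := (((hasDerivAt_id x).ofReal_comp.sub_const
    (3 * (ε₂ : ℂ) * (ρ₂ : ℂ) ^ 2 * (t : ℂ))).const_mul (p i)).add_const (p i ^ 3 * (t : ℂ) + ξ₀ i)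
  simpa [phase, add_assoc] using h

lemma hasDerivAt_phase_t (x t : ℝ) (i : Fin N) :
    HasDerivAt (fun s : ℝ => phase ε₂ ρ₂ p ξ₀ x s i)
      (p i ^ 3 - 3 * ((ε₂ : ℂ) * (ρ₂ : ℂ) ^ 2) * p i) t := by
  have h0 : HasDerivAt (fun s : ℝ => (s : ℂ)) 1 t := (hasDerivAt_id t).ofReal_comp
  have h := (((h0.const_mul (3 * (ε₂ : ℂ) * (ρ₂ : ℂ) ^ 2)).const_sub (x : ℂ)).const_mul
    (p i)).add ((h0.const_mul (p i ^ 3)).add_const (ξ₀ i))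
  refine (h.congr_deriv (by ring)).congr_of_eventuallyEq (Filter.Eventually.of_forall fun s => ?_)
  simp [phase, add_assoc]

lemma hasDerivAt_col_x (k : ℕ) (x t : ℝ) (i : Fin N) :
    HasDerivAt (fun y => col ε₂ ρ₂ p ξ₀ k y t i) (col ε₂ ρ₂ p ξ₀ (k + 1) x t i) x := by
  refine ((hasDerivAt_phase_x ε₂ ρ₂ p ξ₀ x t i).cexp.const_mul (p i ^ k)).congr_deriv ?_
  simp only [col]; ring

lemma hasDerivAt_row_x (k : ℕ) (x t : ℝ) (i : Fin N) :
    HasDerivAt (fun y => row ε₂ ρ₂ p ξ₀ k y t i) (row ε₂ ρ₂ p ξ₀ (k + 1) x t i) x := by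
  refine ((hasDerivAt_phase_x ε₂ ρ₂ p ξ₀ x t i).cexp.star.const_mul
    (conj (p i) ^ k)).congr_deriv ?_
  simp only [row, ← starRingEnd_apply, map_mul]; ring

lemma hasDerivAt_col_t (k : ℕ) (x t : ℝ) (i : Fin N) :
    HasDerivAt (fun s => col ε₂ ρ₂ p ξ₀ k x s i)
      ((col ε₂ ρ₂ p ξ₀ (k + 3) x t
        + (-3 * ((ε₂ : ℂ) * (ρ₂ : ℂ) ^ 2)) • col ε₂ ρ₂ p ξ₀ (k + 1) x t) i) t := by
  refine ((hasDerivAt_phase_t ε₂ ρ₂ p ξ₀ x t i).cexp.const_mul (p i ^ k)).congr_deriv ?_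
  simp only [col, Pi.add_apply, Pi.smul_apply, smul_eq_mul]; ring

lemma hasDerivAt_row_t (k : ℕ) (x t : ℝ) (i : Fin N) :
    HasDerivAt (fun s => row ε₂ ρ₂ p ξ₀ k x s i)
      ((row ε₂ ρ₂ p ξ₀ (k + 3) x t
        + (-3 * ((ε₂ : ℂ) * (ρ₂ : ℂ) ^ 2)) • row ε₂ ρ₂ p ξ₀ (k + 1) x t) i) t := by
  refine ((hasDerivAt_phase_t ε₂ ρ₂ p ξ₀ x t i).cexp.star.const_mul
    (conj (p i) ^ k)).congr_deriv ?_
  simp only [row, Pi.add_apply, Pi.smul_apply, smul_eq_mul, ← starRingEnd_apply, map_mul, map_sub,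
    map_pow, Complex.conj_ofReal, map_ofNat]
  ring

lemma darkRow_eq (x t : ℝ) (j : Fin N) : darkRow ε₂ ρ₂ α₂ p ξ₀ x t j
    = (conj (p j) + Complex.I * α₂)⁻¹ * row ε₂ ρ₂ p ξ₀ 0 x t j := by
  simp [darkRow, row, div_eq_inv_mul]

variable {p}

/-- Differentiating `e^{ξ^*}` brings down `p^* = (p^* + i α₂) - i α₂`. -/
lemma hasDerivAt_darkRow_x (hp : ∀ i j, p i + conj (p j) ≠ 0) (x t : ℝ) (i : Fin N) :
    HasDerivAt (fun y => darkRow ε₂ ρ₂ α₂ p ξ₀ y t i)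
      ((row ε₂ ρ₂ p ξ₀ 0 x t + (-(Complex.I * α₂)) • darkRow ε₂ ρ₂ α₂ p ξ₀ x t) i) x := by
  have he := conj_add_ne_zero α₂ hp i
  simp only [darkRow_eq]
  refine ((hasDerivAt_row_x ε₂ ρ₂ p ξ₀ 0 x t i).const_mul _).congr_deriv ?_
  simp only [row, Pi.add_apply, Pi.smul_apply, smul_eq_mul, darkRow]
  field_simp
  ring

lemma hasDerivAt_darkRow_t (hp : ∀ i j, p i + conj (p j) ≠ 0) (x t : ℝ) (i : Fin N) :
    HasDerivAt (fun s => darkRow ε₂ ρ₂ α₂ p ξ₀ x s i)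
      ((row ε₂ ρ₂ p ξ₀ 2 x t + ((-(Complex.I * α₂)) • row ε₂ ρ₂ p ξ₀ 1 x t
        + (((Complex.I * α₂) ^ 2 - 3 * ((ε₂ : ℂ) * (ρ₂ : ℂ) ^ 2)) • row ε₂ ρ₂ p ξ₀ 0 x t
        + (-(Complex.I * α₂) ^ 3 + 3 * ((ε₂ : ℂ) * (ρ₂ : ℂ) ^ 2) * (Complex.I * α₂))
          • darkRow ε₂ ρ₂ α₂ p ξ₀ x t))) i) t := by
  have he := conj_add_ne_zero α₂ hp i
  simp only [darkRow_eq]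
  refine ((hasDerivAt_row_t ε₂ ρ₂ p ξ₀ 0 x t i).const_mul _).congr_deriv ?_
  simp only [row, Pi.add_apply, Pi.smul_apply, smul_eq_mul, darkRow]
  generalize Complex.I * (α₂ : ℂ) = a at *
  field_simp
  ring

lemma matM_zero_apply (x t : ℝ) (i j : Fin N) :
    matM ε₁ ε₂ ρ₂ α₂ p ξ₀ C 0 x t i j =
      (p i + conj (p j))⁻¹ * (col ε₂ ρ₂ p ξ₀ 0 x t i * row ε₂ ρ₂ p ξ₀ 0 x t j)
      + (ε₁ : ℂ) * conj (C i) * C j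
        / ((p i + conj (p j))
          * ((ε₂ : ℂ) * (ρ₂ : ℂ) ^ 2
              / ((p i - Complex.I * (α₂ : ℂ)) * (conj (p j) + Complex.I * (α₂ : ℂ))) - 1)) := by
  simp [matM, col, row, Complex.exp_add, Complex.exp_conj]

/-- The `x`-derivative of `M₀` is the rank-one matrix `Φ Φ†`. -/
lemma hasDerivAt_matM_x (hp : ∀ i j, p i + conj (p j) ≠ 0) (x t : ℝ) (i j : Fin N) :
    HasDerivAt (fun y => matM ε₁ ε₂ ρ₂ α₂ p ξ₀ C 0 y t i j)
      (vecMulVec (col ε₂ ρ₂ p ξ₀ 0 x t) (row ε₂ ρ₂ p ξ₀ 0 x t) i j) x := by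
  have h := hp i j
  simp only [matM_zero_apply]
  refine ((((hasDerivAt_col_x ε₂ ρ₂ p ξ₀ 0 x t i).mul
    (hasDerivAt_row_x ε₂ ρ₂ p ξ₀ 0 x t j)).const_mul _).add_const _).congr_deriv ?_
  simp only [col, row, vecMulVec_apply]
  field_simp
  ring

/-- The `t`-derivative of `M₀` has rank at most three, since `p³ + q³` is divisible by `p + q`. -/
lemma hasDerivAt_matM_t (hp : ∀ i j, p i + conj (p j) ≠ 0) (x t : ℝ) (i j : Fin N) :
    HasDerivAt (fun s => matM ε₁ ε₂ ρ₂ α₂ p ξ₀ C 0 x s i j)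
      ((vecMulVec (col ε₂ ρ₂ p ξ₀ 2 x t) (row ε₂ ρ₂ p ξ₀ 0 x t)
        - vecMulVec (col ε₂ ρ₂ p ξ₀ 1 x t) (row ε₂ ρ₂ p ξ₀ 1 x t)
        + vecMulVec (col ε₂ ρ₂ p ξ₀ 0 x t) (row ε₂ ρ₂ p ξ₀ 2 x t)
        - (3 * ((ε₂ : ℂ) * (ρ₂ : ℂ) ^ 2)) •
          vecMulVec (col ε₂ ρ₂ p ξ₀ 0 x t) (row ε₂ ρ₂ p ξ₀ 0 x t)) i j) t := by
  have h := hp i j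
  simp only [matM_zero_apply]
  refine ((((hasDerivAt_col_t ε₂ ρ₂ p ξ₀ 0 x t i).mul
    (hasDerivAt_row_t ε₂ ρ₂ p ξ₀ 0 x t j)).const_mul _).add_const _).congr_deriv ?_
  simp only [col, row, vecMulVec_apply, Matrix.add_apply, Matrix.sub_apply, Matrix.smul_apply,
    Pi.add_apply, Pi.smul_apply, smul_eq_mul]
  field_simp
  ring

lemma isHermitian_matM (x t : ℝ) : (matM ε₁ ε₂ ρ₂ α₂ p ξ₀ C 0 x t).IsHermitian := by
  ext i j
  simp only [conjTranspose_apply, matM_zero_apply, col, row, ← starRingEnd_apply, map_add, map_mul,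
    map_div₀, map_sub, map_inv₀, map_pow, map_one, Complex.conj_conj, Complex.conj_ofReal,
    Complex.conj_I]
  congr 1
  · rw [add_comm (conj (p j))]; ring
  · rw [add_comm (conj (p j))]
    ring

variable {C ξ₀} {x t : ℝ}

lemma hasDerivAt_bracket_x (hp : ∀ i j, p i + conj (p j) ≠ 0)
    (hf : tauF ε₁ ε₂ ρ₂ α₂ p ξ₀ C x t ≠ 0) {r : ℝ → Fin N → ℂ} {r' : Fin N → ℂ}
    (hr : ∀ j, HasDerivAt (fun y => r y j) (r' j) x) (k : ℕ) :
    HasDerivAt (fun y => bracket (matM ε₁ ε₂ ρ₂ α₂ p ξ₀ C 0 y t) (r y) (col ε₂ ρ₂ p ξ₀ k y t))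
      (bracket (matM ε₁ ε₂ ρ₂ α₂ p ξ₀ C 0 x t) r' (col ε₂ ρ₂ p ξ₀ k x t)
        + bracket (matM ε₁ ε₂ ρ₂ α₂ p ξ₀ C 0 x t) (r x) (col ε₂ ρ₂ p ξ₀ (k + 1) x t)
        - bracket (matM ε₁ ε₂ ρ₂ α₂ p ξ₀ C 0 x t) (r x) (col ε₂ ρ₂ p ξ₀ 0 x t)
          * potT ε₁ ε₂ ρ₂ α₂ p ξ₀ C 0 k x t) x := by
  refine (hasDerivAt_bracket (hasDerivAt_matM_x ε₁ ε₂ ρ₂ α₂ ξ₀ C hp x t) hf hr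
    (hasDerivAt_col_x ε₂ ρ₂ p ξ₀ k x t)).congr_deriv ?_
  rw [dotProduct_inv_vecMulVec_inv, potT]

lemma hasDerivAt_bracket_t (hp : ∀ i j, p i + conj (p j) ≠ 0)
    (hf : tauF ε₁ ε₂ ρ₂ α₂ p ξ₀ C x t ≠ 0) {r : ℝ → Fin N → ℂ} {r' : Fin N → ℂ}
    (hr : ∀ j, HasDerivAt (fun s => r s j) (r' j) t) (b : ℕ → ℂ)
    (hb : ∀ k, b k = bracket (matM ε₁ ε₂ ρ₂ α₂ p ξ₀ C 0 x t) (r t) (col ε₂ ρ₂ p ξ₀ k x t)) :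
    HasDerivAt (fun s => bracket (matM ε₁ ε₂ ρ₂ α₂ p ξ₀ C 0 x s) (r s) (col ε₂ ρ₂ p ξ₀ 0 x s))
      (bracket (matM ε₁ ε₂ ρ₂ α₂ p ξ₀ C 0 x t) r' (col ε₂ ρ₂ p ξ₀ 0 x t)
        + b 3 - 3 * ((ε₂ : ℂ) * (ρ₂ : ℂ) ^ 2) * b 1
        - (b 2 * potT ε₁ ε₂ ρ₂ α₂ p ξ₀ C 0 0 x t - b 1 * potT ε₁ ε₂ ρ₂ α₂ p ξ₀ C 1 0 x t
          + b 0 * potT ε₁ ε₂ ρ₂ α₂ p ξ₀ C 2 0 x t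
          - 3 * ((ε₂ : ℂ) * (ρ₂ : ℂ) ^ 2) * (b 0 * potT ε₁ ε₂ ρ₂ α₂ p ξ₀ C 0 0 x t))) t := by
  refine (hasDerivAt_bracket (hasDerivAt_matM_t ε₁ ε₂ ρ₂ α₂ ξ₀ C hp x t) hf hr
    (hasDerivAt_col_t ε₂ ρ₂ p ξ₀ 0 x t)).congr_deriv ?_
  simp only [Matrix.mul_add, Matrix.mul_sub, Matrix.add_mul, Matrix.sub_mul, Matrix.mul_smul,
    Matrix.smul_mul, add_mulVec, sub_mulVec, smul_mulVec, dotProduct_add, dotProduct_sub,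
    dotProduct_smul, dotProduct_inv_vecMulVec_inv, bracket_add_right, bracket_smul_right, hb, potT,
    smul_eq_mul]
  ring

lemma hasDerivAt_potT_x (hp : ∀ i j, p i + conj (p j) ≠ 0)
    (hf : tauF ε₁ ε₂ ρ₂ α₂ p ξ₀ C x t ≠ 0) (j k : ℕ) :
    HasDerivAt (fun y => potT ε₁ ε₂ ρ₂ α₂ p ξ₀ C j k y t)
      (potT ε₁ ε₂ ρ₂ α₂ p ξ₀ C (j + 1) k x t + potT ε₁ ε₂ ρ₂ α₂ p ξ₀ C j (k + 1) x t
        - potT ε₁ ε₂ ρ₂ α₂ p ξ₀ C j 0 x t * potT ε₁ ε₂ ρ₂ α₂ p ξ₀ C 0 k x t) x :=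
  hasDerivAt_bracket_x ε₁ ε₂ ρ₂ α₂ hp hf (hasDerivAt_row_x ε₂ ρ₂ p ξ₀ j x t) k

lemma hasDerivAt_potR_x (hp : ∀ i j, p i + conj (p j) ≠ 0)
    (hf : tauF ε₁ ε₂ ρ₂ α₂ p ξ₀ C x t ≠ 0) (k : ℕ) :
    HasDerivAt (fun y => potR ε₁ ε₂ ρ₂ α₂ p ξ₀ C k y t)
      (potR ε₁ ε₂ ρ₂ α₂ p ξ₀ C (k + 1) x t
        - potR ε₁ ε₂ ρ₂ α₂ p ξ₀ C 0 x t * potT ε₁ ε₂ ρ₂ α₂ p ξ₀ C 0 k x t) x := by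
  refine (hasDerivAt_bracket_x ε₁ ε₂ ρ₂ α₂ hp hf (r := fun _ => C) (r' := 0)
    (fun j => hasDerivAt_const x (C j)) k).congr_deriv ?_
  simp [bracket, potR]

lemma hasDerivAt_potW_x (hp : ∀ i j, p i + conj (p j) ≠ 0)
    (hf : tauF ε₁ ε₂ ρ₂ α₂ p ξ₀ C x t ≠ 0) (k : ℕ) :
    HasDerivAt (fun y => potW ε₁ ε₂ ρ₂ α₂ p ξ₀ C k y t)
      (potT ε₁ ε₂ ρ₂ α₂ p ξ₀ C 0 k x t - Complex.I * α₂ * potW ε₁ ε₂ ρ₂ α₂ p ξ₀ C k x t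
        + potW ε₁ ε₂ ρ₂ α₂ p ξ₀ C (k + 1) x t
        - potW ε₁ ε₂ ρ₂ α₂ p ξ₀ C 0 x t * potT ε₁ ε₂ ρ₂ α₂ p ξ₀ C 0 k x t) x := by
  refine (hasDerivAt_bracket_x ε₁ ε₂ ρ₂ α₂ hp hf
    (hasDerivAt_darkRow_x ε₂ ρ₂ α₂ ξ₀ hp x t) k).congr_deriv ?_
  simp only [bracket_add_left, bracket_smul_left, potW, potT]
  ring

lemma hasDerivAt_potR_t (hp : ∀ i j, p i + conj (p j) ≠ 0)
    (hf : tauF ε₁ ε₂ ρ₂ α₂ p ξ₀ C x t ≠ 0) :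
    HasDerivAt (fun s => potR ε₁ ε₂ ρ₂ α₂ p ξ₀ C 0 x s)
      (potR ε₁ ε₂ ρ₂ α₂ p ξ₀ C 3 x t
        - 3 * ((ε₂ : ℂ) * (ρ₂ : ℂ) ^ 2) * potR ε₁ ε₂ ρ₂ α₂ p ξ₀ C 1 x t
        - (potR ε₁ ε₂ ρ₂ α₂ p ξ₀ C 2 x t * potT ε₁ ε₂ ρ₂ α₂ p ξ₀ C 0 0 x t
          - potR ε₁ ε₂ ρ₂ α₂ p ξ₀ C 1 x t * potT ε₁ ε₂ ρ₂ α₂ p ξ₀ C 1 0 x t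
          + potR ε₁ ε₂ ρ₂ α₂ p ξ₀ C 0 x t * potT ε₁ ε₂ ρ₂ α₂ p ξ₀ C 2 0 x t
          - 3 * ((ε₂ : ℂ) * (ρ₂ : ℂ) ^ 2) *
            (potR ε₁ ε₂ ρ₂ α₂ p ξ₀ C 0 x t * potT ε₁ ε₂ ρ₂ α₂ p ξ₀ C 0 0 x t))) t := by
  refine (hasDerivAt_bracket_t ε₁ ε₂ ρ₂ α₂ hp hf (r := fun _ => C) (r' := 0)
    (fun j => hasDerivAt_const t (C j)) (fun k => potR ε₁ ε₂ ρ₂ α₂ p ξ₀ C k x t)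
    (fun k => rfl)).congr_deriv ?_
  simp [bracket]

lemma hasDerivAt_potW_t (hp : ∀ i j, p i + conj (p j) ≠ 0)
    (hf : tauF ε₁ ε₂ ρ₂ α₂ p ξ₀ C x t ≠ 0) :
    HasDerivAt (fun s => potW ε₁ ε₂ ρ₂ α₂ p ξ₀ C 0 x s)
      (potT ε₁ ε₂ ρ₂ α₂ p ξ₀ C 2 0 x t - Complex.I * α₂ * potT ε₁ ε₂ ρ₂ α₂ p ξ₀ C 1 0 x t
        + ((Complex.I * α₂) ^ 2 - 3 * ((ε₂ : ℂ) * (ρ₂ : ℂ) ^ 2))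
          * potT ε₁ ε₂ ρ₂ α₂ p ξ₀ C 0 0 x t
        + (-(Complex.I * α₂) ^ 3 + 3 * ((ε₂ : ℂ) * (ρ₂ : ℂ) ^ 2) * (Complex.I * α₂))
          * potW ε₁ ε₂ ρ₂ α₂ p ξ₀ C 0 x t
        + potW ε₁ ε₂ ρ₂ α₂ p ξ₀ C 3 x t
        - 3 * ((ε₂ : ℂ) * (ρ₂ : ℂ) ^ 2) * potW ε₁ ε₂ ρ₂ α₂ p ξ₀ C 1 x t
        - (potW ε₁ ε₂ ρ₂ α₂ p ξ₀ C 2 x t * potT ε₁ ε₂ ρ₂ α₂ p ξ₀ C 0 0 x t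
          - potW ε₁ ε₂ ρ₂ α₂ p ξ₀ C 1 x t * potT ε₁ ε₂ ρ₂ α₂ p ξ₀ C 1 0 x t
          + potW ε₁ ε₂ ρ₂ α₂ p ξ₀ C 0 x t * potT ε₁ ε₂ ρ₂ α₂ p ξ₀ C 2 0 x t
          - 3 * ((ε₂ : ℂ) * (ρ₂ : ℂ) ^ 2) *
            (potW ε₁ ε₂ ρ₂ α₂ p ξ₀ C 0 x t * potT ε₁ ε₂ ρ₂ α₂ p ξ₀ C 0 0 x t))) t := by
  refine (hasDerivAt_bracket_t ε₁ ε₂ ρ₂ α₂ hp hf (hasDerivAt_darkRow_t ε₂ ρ₂ α₂ ξ₀ hp x t)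
    (fun k => potW ε₁ ε₂ ρ₂ α₂ p ξ₀ C k x t) (fun k => rfl)).congr_deriv ?_
  simp only [bracket_add_left, bracket_smul_left, potW, potT]
  ring

end Data

/-! ### The Sylvester equation and its consequences -/

section Identities
variable {N : ℕ} (ε₁ ε₂ ρ₂ α₂ : ℝ) {p ξ₀ C : Fin N → ℂ} {x t : ℝ}

lemma conj_potR (k : ℕ) : conj (potR ε₁ ε₂ ρ₂ α₂ p ξ₀ C k x t)
    = bracket (matM ε₁ ε₂ ρ₂ α₂ p ξ₀ C 0 x t) (row ε₂ ρ₂ p ξ₀ k x t) (star C) := by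
  rw [potR, conj_bracket (isHermitian_matM ε₁ ε₂ ρ₂ α₂ ξ₀ C x t)]
  congr 1
  ext i
  simp [col, row]

lemma conj_potW_zero : conj (potW ε₁ ε₂ ρ₂ α₂ p ξ₀ C 0 x t)
    = bracket (matM ε₁ ε₂ ρ₂ α₂ p ξ₀ C 0 x t) (row ε₂ ρ₂ p ξ₀ 0 x t)
      (star (darkRow ε₂ ρ₂ α₂ p ξ₀ x t)) := by
  rw [potW, conj_bracket (isHermitian_matM ε₁ ε₂ ρ₂ α₂ ξ₀ C x t)]
  congr 1
  ext i
  simp [col, row]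

lemma star_darkRow (i : Fin N) : star (darkRow ε₂ ρ₂ α₂ p ξ₀ x t) i
    = (p i - Complex.I * α₂)⁻¹ * col ε₂ ρ₂ p ξ₀ 0 x t i := by
  simp [darkRow, col, div_eq_inv_mul, sub_eq_add_neg]

/-- The Sylvester-type equation of `M₀`: with `dᵢ = pᵢ - i α₂` and `κ = ε₂ ρ₂²`, multiplying the
entries by `(κ / dᵢ - dᵢ) + (κ / dⱼ^* - dⱼ^*)` cancels all denominators and leaves three rank-one
terms. -/
lemma matM_sylvester (hp : ∀ i j, p i + conj (p j) ≠ 0)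
    (hq : ∀ i j, (ε₂ : ℂ) * (ρ₂ : ℂ) ^ 2
      / ((p i - Complex.I * (α₂ : ℂ)) * (conj (p j) + Complex.I * (α₂ : ℂ))) ≠ 1)
    (i j : Fin N) :
    ((ε₂ : ℂ) * (ρ₂ : ℂ) ^ 2 / (p i - Complex.I * α₂) - (p i - Complex.I * α₂))
        * matM ε₁ ε₂ ρ₂ α₂ p ξ₀ C 0 x t i j
      + matM ε₁ ε₂ ρ₂ α₂ p ξ₀ C 0 x t i j
        * ((ε₂ : ℂ) * (ρ₂ : ℂ) ^ 2 / (conj (p j) + Complex.I * α₂)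
          - (conj (p j) + Complex.I * α₂))
    = (ε₂ : ℂ) * (ρ₂ : ℂ) ^ 2 * (star (darkRow ε₂ ρ₂ α₂ p ξ₀ x t) i * darkRow ε₂ ρ₂ α₂ p ξ₀ x t j)
      - col ε₂ ρ₂ p ξ₀ 0 x t i * row ε₂ ρ₂ p ξ₀ 0 x t j + (ε₁ : ℂ) * (star C i * C j) := by
  have hd := sub_ne_zero_of_add_conj α₂ hp i
  have he := conj_add_ne_zero α₂ hp j
  have hpij := hp i j
  have hqij := hq i j
  rw [star_darkRow, darkRow_eq, matM_zero_apply, Pi.star_apply, ← starRingEnd_apply]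
  have hsum : p i + conj (p j)
      = (p i - Complex.I * α₂) + (conj (p j) + Complex.I * α₂) := by ring
  rw [hsum] at hpij ⊢
  generalize p i - Complex.I * (α₂ : ℂ) = d at *
  generalize conj (p j) + Complex.I * (α₂ : ℂ) = e at *
  generalize (ε₂ : ℂ) * (ρ₂ : ℂ) ^ 2 = κ at *
  have hqd : κ / (d * e) - 1 ≠ 0 := sub_ne_zero.2 hqij
  have hl : (κ / d - d) + (κ / e - e) = (d + e) * (κ / (d * e) - 1) := by
    field_simp
    ring
  have key : ∀ Z c : ℂ, (κ / d - d) * ((d + e)⁻¹ * Z + c / ((d + e) * (κ / (d * e) - 1)))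
      + ((d + e)⁻¹ * Z + c / ((d + e) * (κ / (d * e) - 1))) * (κ / e - e)
      = (κ / (d * e) - 1) * Z + c := by
    intro Z c
    rw [mul_comm (κ / d - d), ← mul_add, hl, add_mul, div_mul_cancel₀ _ (mul_ne_zero hpij hqd)]
    congr 1
    field_simp
  rw [key]
  field_simp

/-- The bilinear relation `ε₁ |u₁|² + ε₂ |u₂|² = ε₂ ρ₂² - (log f)_xx`. -/
lemma intensity_identity (hp : ∀ i j, p i + conj (p j) ≠ 0)
    (hq : ∀ i j, (ε₂ : ℂ) * (ρ₂ : ℂ) ^ 2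
      / ((p i - Complex.I * (α₂ : ℂ)) * (conj (p j) + Complex.I * (α₂ : ℂ))) ≠ 1)
    (hf : tauF ε₁ ε₂ ρ₂ α₂ p ξ₀ C x t ≠ 0) :
    (ε₁ : ℂ) * (potR ε₁ ε₂ ρ₂ α₂ p ξ₀ C 0 x t * conj (potR ε₁ ε₂ ρ₂ α₂ p ξ₀ C 0 x t))
      + (ε₂ : ℂ) * (ρ₂ : ℂ) ^ 2 * ((1 - potW ε₁ ε₂ ρ₂ α₂ p ξ₀ C 0 x t)
        * (1 - conj (potW ε₁ ε₂ ρ₂ α₂ p ξ₀ C 0 x t)))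
    = (ε₂ : ℂ) * (ρ₂ : ℂ) ^ 2 - (potT ε₁ ε₂ ρ₂ α₂ p ξ₀ C 1 0 x t
        + potT ε₁ ε₂ ρ₂ α₂ p ξ₀ C 0 1 x t - potT ε₁ ε₂ ρ₂ α₂ p ξ₀ C 0 0 x t ^ 2) := by
  have h := bracket_sylvester hf (matM_sylvester ε₁ ε₂ ρ₂ α₂ (ξ₀ := ξ₀) (C := C) (x := x) (t := t)
    hp hq) (row ε₂ ρ₂ p ξ₀ 0 x t) (col ε₂ ρ₂ p ξ₀ 0 x t)
  have h1 : (fun i => (ε₂ : ℂ) * (ρ₂ : ℂ) ^ 2 / (p i - Complex.I * α₂) - (p i - Complex.I * α₂))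
      * col ε₂ ρ₂ p ξ₀ 0 x t = ((ε₂ : ℂ) * (ρ₂ : ℂ) ^ 2) • star (darkRow ε₂ ρ₂ α₂ p ξ₀ x t)
        + ((-1 : ℂ) • col ε₂ ρ₂ p ξ₀ 1 x t + (Complex.I * α₂) • col ε₂ ρ₂ p ξ₀ 0 x t) := by
    ext i
    simp only [Pi.mul_apply, Pi.add_apply, Pi.smul_apply, smul_eq_mul, star_darkRow, col]
    ring
  have h2 : row ε₂ ρ₂ p ξ₀ 0 x t * (fun j => (ε₂ : ℂ) * (ρ₂ : ℂ) ^ 2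
        / (conj (p j) + Complex.I * α₂) - (conj (p j) + Complex.I * α₂))
      = ((ε₂ : ℂ) * (ρ₂ : ℂ) ^ 2) • darkRow ε₂ ρ₂ α₂ p ξ₀ x t
        + ((-1 : ℂ) • row ε₂ ρ₂ p ξ₀ 1 x t + (-(Complex.I * α₂)) • row ε₂ ρ₂ p ξ₀ 0 x t) := by
    ext i
    simp only [Pi.mul_apply, Pi.add_apply, Pi.smul_apply, smul_eq_mul, darkRow_eq, row]
    ring
  rw [h1, h2] at h
  simp only [bracket_add_left, bracket_add_right, bracket_smul_left, bracket_smul_right] at h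
  rw [conj_potR, conj_potW_zero]
  simp only [potT, potR, potW]
  linear_combination -h

/-- The relation for `ε₁ u₁^* u₁_x + ε₂ u₂^* u₂_x`, the factors `potR 1 - ⋯` and
`i α₂ - ⋯` being the `x`-derivatives of `u₁` and `u₂` up to the elementary prefactors. -/
lemma current_identity (hp : ∀ i j, p i + conj (p j) ≠ 0)
    (hq : ∀ i j, (ε₂ : ℂ) * (ρ₂ : ℂ) ^ 2
      / ((p i - Complex.I * (α₂ : ℂ)) * (conj (p j) + Complex.I * (α₂ : ℂ))) ≠ 1)
    (hf : tauF ε₁ ε₂ ρ₂ α₂ p ξ₀ C x t ≠ 0) :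
    (ε₁ : ℂ) * (conj (potR ε₁ ε₂ ρ₂ α₂ p ξ₀ C 0 x t) * (potR ε₁ ε₂ ρ₂ α₂ p ξ₀ C 1 x t
        - potT ε₁ ε₂ ρ₂ α₂ p ξ₀ C 0 0 x t * potR ε₁ ε₂ ρ₂ α₂ p ξ₀ C 0 x t))
      + (ε₂ : ℂ) * (ρ₂ : ℂ) ^ 2 * ((1 - conj (potW ε₁ ε₂ ρ₂ α₂ p ξ₀ C 0 x t))
        * (Complex.I * α₂ - potT ε₁ ε₂ ρ₂ α₂ p ξ₀ C 0 0 x t - potW ε₁ ε₂ ρ₂ α₂ p ξ₀ C 1 x t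
          + potT ε₁ ε₂ ρ₂ α₂ p ξ₀ C 0 0 x t * potW ε₁ ε₂ ρ₂ α₂ p ξ₀ C 0 x t))
    = (ε₂ : ℂ) * (ρ₂ : ℂ) ^ 2 * (Complex.I * α₂) - potT ε₁ ε₂ ρ₂ α₂ p ξ₀ C 0 2 x t
        - potT ε₁ ε₂ ρ₂ α₂ p ξ₀ C 1 1 x t
        + 2 * potT ε₁ ε₂ ρ₂ α₂ p ξ₀ C 0 0 x t * potT ε₁ ε₂ ρ₂ α₂ p ξ₀ C 0 1 x t
        + potT ε₁ ε₂ ρ₂ α₂ p ξ₀ C 0 0 x t * potT ε₁ ε₂ ρ₂ α₂ p ξ₀ C 1 0 x t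
        - potT ε₁ ε₂ ρ₂ α₂ p ξ₀ C 0 0 x t ^ 3 := by
  have h0 := intensity_identity ε₁ ε₂ ρ₂ α₂ hp hq hf
  have h := bracket_sylvester hf (matM_sylvester ε₁ ε₂ ρ₂ α₂ (ξ₀ := ξ₀) (C := C) (x := x) (t := t)
    hp hq) (row ε₂ ρ₂ p ξ₀ 0 x t) (col ε₂ ρ₂ p ξ₀ 1 x t)
  have h1 : (fun i => (ε₂ : ℂ) * (ρ₂ : ℂ) ^ 2 / (p i - Complex.I * α₂) - (p i - Complex.I * α₂))
      * col ε₂ ρ₂ p ξ₀ 1 x t = ((ε₂ : ℂ) * (ρ₂ : ℂ) ^ 2) • col ε₂ ρ₂ p ξ₀ 0 x t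
        + (((ε₂ : ℂ) * (ρ₂ : ℂ) ^ 2 * (Complex.I * α₂)) • star (darkRow ε₂ ρ₂ α₂ p ξ₀ x t)
        + ((-1 : ℂ) • col ε₂ ρ₂ p ξ₀ 2 x t + (Complex.I * α₂) • col ε₂ ρ₂ p ξ₀ 1 x t)) := by
    ext i
    have hd := sub_ne_zero_of_add_conj α₂ hp i
    simp only [Pi.mul_apply, Pi.add_apply, Pi.smul_apply, smul_eq_mul, star_darkRow, col]
    generalize Complex.I * (α₂ : ℂ) = a at *
    field_simp
    ring
  have h2 : row ε₂ ρ₂ p ξ₀ 0 x t * (fun j => (ε₂ : ℂ) * (ρ₂ : ℂ) ^ 2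
        / (conj (p j) + Complex.I * α₂) - (conj (p j) + Complex.I * α₂))
      = ((ε₂ : ℂ) * (ρ₂ : ℂ) ^ 2) • darkRow ε₂ ρ₂ α₂ p ξ₀ x t
        + ((-1 : ℂ) • row ε₂ ρ₂ p ξ₀ 1 x t + (-(Complex.I * α₂)) • row ε₂ ρ₂ p ξ₀ 0 x t) := by
    ext i
    simp only [Pi.mul_apply, Pi.add_apply, Pi.smul_apply, smul_eq_mul, darkRow_eq, row]
    ring
  rw [h1, h2] at h
  simp only [bracket_add_left, bracket_add_right, bracket_smul_left, bracket_smul_right] at h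
  rw [conj_potR, conj_potW_zero] at h0 ⊢
  simp only [potT, potR, potW] at h0 ⊢
  -- The terms quadratic in `potR 0` and `1 - potW 0` are eliminated by the intensity relation.
  linear_combination -h - bracket (matM ε₁ ε₂ ρ₂ α₂ p ξ₀ C 0 x t) (row ε₂ ρ₂ p ξ₀ 0 x t)
    (col ε₂ ρ₂ p ξ₀ 0 x t) * h0

end Identities

/-! ### Smoothness and the determinantal formulas -/

section Solution
variable {N : ℕ} (ε₁ ε₂ ρ₂ α₂ : ℝ) (p ξ₀ C : Fin N → ℂ)

lemma contDiff_matM (k : ℤ) (i j : Fin N) :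
    ContDiff ℝ ∞ fun z : ℝ × ℝ => matM ε₁ ε₂ ρ₂ α₂ p ξ₀ C k z.1 z.2 i j := by
  have h1 : ContDiff ℝ ∞ fun z : ℝ × ℝ => (z.1 : ℂ) := Complex.ofRealCLM.contDiff.comp contDiff_fst
  have h2 : ContDiff ℝ ∞ fun z : ℝ × ℝ => (z.2 : ℂ) := Complex.ofRealCLM.contDiff.comp contDiff_snd
  have h3 : ∀ i, ContDiff ℝ ∞ fun z : ℝ × ℝ => phase ε₂ ρ₂ p ξ₀ z.1 z.2 i := fun i => by
    unfold phase; fun_prop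
  have h4 : ContDiff ℝ ∞ fun z : ℝ × ℝ => conj (phase ε₂ ρ₂ p ξ₀ z.1 z.2 j) :=
    Complex.conjCLE.contDiff.comp (h3 j)
  simp only [matM, Matrix.of_apply]
  exact (contDiff_const.mul ((h3 i).add h4).cexp).add contDiff_const

lemma contDiff_tauF : ContDiff ℝ ∞ fun z : ℝ × ℝ => tauF ε₁ ε₂ ρ₂ α₂ p ξ₀ C z.1 z.2 :=
  contDiff_det (contDiff_matM ε₁ ε₂ ρ₂ α₂ p ξ₀ C 0)

lemma contDiff_tauH : ContDiff ℝ ∞ fun z : ℝ × ℝ => tauH ε₁ ε₂ ρ₂ α₂ p ξ₀ C z.1 z.2 :=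
  contDiff_det (contDiff_matM ε₁ ε₂ ρ₂ α₂ p ξ₀ C 1)

lemma contDiff_tauG : ContDiff ℝ ∞ fun z : ℝ × ℝ => tauG ε₁ ε₂ ρ₂ α₂ p ξ₀ C z.1 z.2 := by
  have h1 : ContDiff ℝ ∞ fun z : ℝ × ℝ => (z.1 : ℂ) := Complex.ofRealCLM.contDiff.comp contDiff_fst
  have h2 : ContDiff ℝ ∞ fun z : ℝ × ℝ => (z.2 : ℂ) := Complex.ofRealCLM.contDiff.comp contDiff_snd
  refine contDiff_det fun i j => ?_
  rcases i with i | i <;> rcases j with j | j <;>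
    simp only [fromBlocks_apply₁₁, fromBlocks_apply₁₂, fromBlocks_apply₂₁, fromBlocks_apply₂₂,
      Matrix.of_apply, Matrix.zero_apply]
  · exact contDiff_matM ε₁ ε₂ ρ₂ α₂ p ξ₀ C 0 i j
  · unfold phase; fun_prop
  · fun_prop
  · fun_prop

lemma isOpen_tauF_ne_zero : IsOpen {z : ℝ × ℝ | tauF ε₁ ε₂ ρ₂ α₂ p ξ₀ C z.1 z.2 ≠ 0} :=
  isOpen_ne_fun (contDiff_tauF ε₁ ε₂ ρ₂ α₂ p ξ₀ C).continuous continuous_const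

variable {p ξ₀ C} {x t : ℝ}

lemma eventually_tauF_x (hf : tauF ε₁ ε₂ ρ₂ α₂ p ξ₀ C x t ≠ 0) :
    ∀ᶠ y in 𝓝 x, tauF ε₁ ε₂ ρ₂ α₂ p ξ₀ C y t ≠ 0 :=
  ((contDiff_tauF ε₁ ε₂ ρ₂ α₂ p ξ₀ C).continuous.comp
    (Continuous.prodMk continuous_id continuous_const)).continuousAt.eventually_ne hf

lemma eventually_tauF_t (hf : tauF ε₁ ε₂ ρ₂ α₂ p ξ₀ C x t ≠ 0) :
    ∀ᶠ s in 𝓝 t, tauF ε₁ ε₂ ρ₂ α₂ p ξ₀ C x s ≠ 0 :=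
  ((contDiff_tauF ε₁ ε₂ ρ₂ α₂ p ξ₀ C).continuous.comp
    (Continuous.prodMk continuous_const continuous_id)).continuousAt.eventually_ne hf

/-- The elementary factor of the bright component. -/
noncomputable def brightExp (t : ℝ) : ℂ :=
  Complex.exp (-3 * Complex.I * (ρ₂ : ℂ) ^ 2 * (ε₂ : ℂ) * (α₂ : ℂ) * (t : ℂ))

/-- The elementary factor of the dark component. -/
noncomputable def darkExp (x t : ℝ) : ℂ :=
  Complex.exp (Complex.I * ((α₂ : ℂ) * (x : ℂ)
        - ((α₂ : ℂ) ^ 3 + 6 * (ε₂ : ℂ) * (α₂ : ℂ) * (ρ₂ : ℂ) ^ 2) * (t : ℂ)))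

lemma norm_darkExp : ‖darkExp ε₂ ρ₂ α₂ x t‖ = 1 := by
  have : darkExp ε₂ ρ₂ α₂ x t
      = Complex.exp (((α₂ * x - (α₂ ^ 3 + 6 * ε₂ * α₂ * ρ₂ ^ 2) * t : ℝ) : ℂ) * Complex.I) := by
    rw [darkExp, mul_comm]; push_cast; rfl
  rw [this, Complex.norm_exp_ofReal_mul_I]

lemma norm_brightExp : ‖brightExp ε₂ ρ₂ α₂ t‖ = 1 := by
  have : brightExp ε₂ ρ₂ α₂ t
      = Complex.exp (((-3 * ρ₂ ^ 2 * ε₂ * α₂ * t : ℝ) : ℂ) * Complex.I) := by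
    rw [brightExp]; push_cast; congr 1; ring
  rw [this, Complex.norm_exp_ofReal_mul_I]

lemma mul_conj_eq_one {z : ℂ} (hz : ‖z‖ = 1) : z * conj z = 1 := by
  rw [Complex.mul_conj', hz]; simp

lemma hasDerivAt_brightExp : HasDerivAt (fun s => brightExp ε₂ ρ₂ α₂ s)
    (-3 * ((ε₂ : ℂ) * (ρ₂ : ℂ) ^ 2) * (Complex.I * α₂) * brightExp ε₂ ρ₂ α₂ t) t := by
  have h0 : HasDerivAt (fun s : ℝ => (s : ℂ)) 1 t := (hasDerivAt_id t).ofReal_comp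
  refine (h0.const_mul _).cexp.congr_deriv ?_
  rw [brightExp]; ring

lemma hasDerivAt_darkExp_x : HasDerivAt (fun y => darkExp ε₂ ρ₂ α₂ y t)
    (Complex.I * α₂ * darkExp ε₂ ρ₂ α₂ x t) x := by
  have h0 : HasDerivAt (fun s : ℝ => (s : ℂ)) 1 x := (hasDerivAt_id x).ofReal_comp
  refine (((h0.const_mul _).sub_const _).const_mul _).cexp.congr_deriv ?_
  rw [darkExp]; ring

lemma hasDerivAt_darkExp_t : HasDerivAt (fun s => darkExp ε₂ ρ₂ α₂ x s)
    (((Complex.I * α₂) ^ 3 - 6 * ((ε₂ : ℂ) * (ρ₂ : ℂ) ^ 2) * (Complex.I * α₂))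
      * darkExp ε₂ ρ₂ α₂ x t) t := by
  have h0 : HasDerivAt (fun s : ℝ => (s : ℂ)) 1 t := (hasDerivAt_id t).ofReal_comp
  refine (((h0.const_mul _).const_sub _).const_mul _).cexp.congr_deriv ?_
  rw [darkExp, mul_pow, Complex.I_pow_three]; ring

/-- The bordered determinant divided by `f`; for `f = 0` both sides are `0`. -/
lemma bright_eq : bright ε₁ ε₂ ρ₂ α₂ p ξ₀ C x t
    = potR ε₁ ε₂ ρ₂ α₂ p ξ₀ C 0 x t * brightExp ε₂ ρ₂ α₂ t := by
  by_cases hf : tauF ε₁ ε₂ ρ₂ α₂ p ξ₀ C x t = 0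
  · have h0 : (matM ε₁ ε₂ ρ₂ α₂ p ξ₀ C 0 x t)⁻¹ = 0 :=
      nonsing_inv_apply_not_isUnit _ (by rw [← tauF, hf]; exact not_isUnit_zero)
    simp [bright, hf, potR, bracket, h0]
  · have hg := det_bordered hf (col ε₂ ρ₂ p ξ₀ 0 x t) C
    simp only [col, pow_zero, one_mul] at hg
    rw [bright, tauG, hg, ← tauF, mul_div_cancel_left₀ _ hf, potR, brightExp]

/-- `M₁` is a rank-one perturbation of `M₀`, because `-d/e = 1 - (d + e)/e`. -/
lemma matM_one (hp : ∀ i j, p i + conj (p j) ≠ 0) : matM ε₁ ε₂ ρ₂ α₂ p ξ₀ C 1 x t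
    = matM ε₁ ε₂ ρ₂ α₂ p ξ₀ C 0 x t
      - vecMulVec (col ε₂ ρ₂ p ξ₀ 0 x t) (darkRow ε₂ ρ₂ α₂ p ξ₀ x t) := by
  ext i j
  have he := conj_add_ne_zero α₂ hp j
  have hpij := hp i j
  simp only [matM, col, darkRow, Matrix.sub_apply, vecMulVec_apply, Matrix.of_apply, zpow_one,
    zpow_zero, Complex.exp_add, Complex.exp_conj]
  rw [add_sub_right_comm]
  congr 1
  generalize Complex.I * (α₂ : ℂ) = a at *
  field_simp
  ring

lemma dark_eq (hp : ∀ i j, p i + conj (p j) ≠ 0) (hf : tauF ε₁ ε₂ ρ₂ α₂ p ξ₀ C x t ≠ 0) :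
    dark ε₁ ε₂ ρ₂ α₂ p ξ₀ C x t
    = (1 - potW ε₁ ε₂ ρ₂ α₂ p ξ₀ C 0 x t) * (ρ₂ * darkExp ε₂ ρ₂ α₂ x t) := by
  rw [dark, tauH, matM_one ε₁ ε₂ ρ₂ α₂ hp, det_sub_vecMulVec hf, ← tauF, mul_div_cancel_left₀ _ hf,
    darkExp, potW, mul_assoc]

/-- Derivatives up to order three of a function from a chain of derivatives near a point. -/
lemma iteratedDeriv_three_of_chain {u v w : ℝ → ℂ} {z : ℂ} {x : ℝ}
    (h1 : ∀ᶠ y in 𝓝 x, HasDerivAt u (v y) y) (h2 : ∀ᶠ y in 𝓝 x, HasDerivAt v (w y) y)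
    (h3 : HasDerivAt w z x) : iteratedDeriv 3 u x = z := by
  have e1 : deriv u =ᶠ[𝓝 x] v := h1.mono fun y hy => hy.deriv
  have e2 : deriv v =ᶠ[𝓝 x] w := h2.mono fun y hy => hy.deriv
  rw [iteratedDeriv_succ', iteratedDeriv_succ', iteratedDeriv_one]
  exact ((e1.deriv.trans e2).deriv_eq).trans h3.deriv

end Solution

/-! ### The coupled Hirota system -/

/-- The first and third derivatives of the head of a sequence with `Y_k' = Y_{k+1} - Y_0 T_{0k}`,
where `T` obeys the differentiation rule of the potentials `potT`. -/
lemma derivs_of_recursion {T : ℕ → ℕ → ℝ → ℂ} {Y : ℕ → ℝ → ℂ} {x : ℝ}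
    (hT : ∀ᶠ y in 𝓝 x, ∀ j k, HasDerivAt (T j k)
      (T (j + 1) k y + T j (k + 1) y - T j 0 y * T 0 k y) y)
    (hY : ∀ᶠ y in 𝓝 x, ∀ k, HasDerivAt (Y k) (Y (k + 1) y - Y 0 y * T 0 k y) y) :
    deriv (Y 0) x = Y 1 x - Y 0 x * T 0 0 x ∧
    iteratedDeriv 3 (Y 0) x = Y 3 x - T 0 0 x * Y 2 x
      + (3 * T 0 0 x ^ 2 - 3 * T 0 1 x - 2 * T 1 0 x) * Y 1 x
      + (-3 * T 0 2 x - 3 * T 1 1 x - T 2 0 x + 9 * T 0 0 x * T 0 1 x + 6 * T 0 0 x * T 1 0 x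
        - 6 * T 0 0 x ^ 3) * Y 0 x := by
  refine ⟨(hY.self_of_nhds 0).deriv, ?_⟩
  -- `v` and `w` are the first two derivatives of `Y 0`.
  refine iteratedDeriv_three_of_chain (v := fun y => Y 1 y - Y 0 y * T 0 0 y)
    (w := fun y => Y 2 y - T 0 0 y * Y 1 y
      + (2 * T 0 0 y ^ 2 - 2 * T 0 1 y - T 1 0 y) * Y 0 y)
    (hY.mono fun y hy => hy 0) ?_ ?_
  · filter_upwards [hT, hY] with y hTy hYy
    refine ((hYy 1).sub ((hYy 0).mul (hTy 0 0))).congr_deriv ?_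
    ring
  · have hTx := hT.self_of_nhds
    have hYx := hY.self_of_nhds
    refine (((hYx 2).sub ((hTx 0 0).mul (hYx 1))).add
      ((((((hTx 0 0).pow 2).const_mul 2).sub ((hTx 0 1).const_mul 2)).sub (hTx 1 0)).mul
        (hYx 0))).congr_deriv ?_
    simp only [Nat.reduceAdd, Nat.cast_ofNat, Nat.add_one_sub_one, pow_one, Pi.pow_apply,
      Pi.sub_apply, zero_add]
    ring

section Solution
variable {N : ℕ} (ε₁ ε₂ ρ₂ α₂ : ℝ) (p ξ₀ C : Fin N → ℂ)

/-- The sequence `Y_k = R_k e^{⋯}` with head `u₁`. -/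
noncomputable def brightSeq (k : ℕ) (x t : ℝ) : ℂ :=
  potR ε₁ ε₂ ρ₂ α₂ p ξ₀ C k x t * brightExp ε₂ ρ₂ α₂ t

/-- The sequence `Y_k = ρ₂ ((i α₂)ᵏ - W_k) e^{⋯}`; its head is `u₂` wherever `f ≠ 0`. -/
noncomputable def darkSeq (k : ℕ) (x t : ℝ) : ℂ :=
  ((Complex.I * α₂) ^ k - potW ε₁ ε₂ ρ₂ α₂ p ξ₀ C k x t) * (ρ₂ * darkExp ε₂ ρ₂ α₂ x t)

variable {p ξ₀ C} {x t : ℝ}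

lemma hasDerivAt_brightSeq_x (hp : ∀ i j, p i + conj (p j) ≠ 0)
    (hf : tauF ε₁ ε₂ ρ₂ α₂ p ξ₀ C x t ≠ 0) (k : ℕ) :
    HasDerivAt (fun y => brightSeq ε₁ ε₂ ρ₂ α₂ p ξ₀ C k y t)
      (brightSeq ε₁ ε₂ ρ₂ α₂ p ξ₀ C (k + 1) x t
        - brightSeq ε₁ ε₂ ρ₂ α₂ p ξ₀ C 0 x t * potT ε₁ ε₂ ρ₂ α₂ p ξ₀ C 0 k x t) x := by
  refine ((hasDerivAt_potR_x ε₁ ε₂ ρ₂ α₂ hp hf k).mul_const _).congr_deriv ?_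
  simp only [brightSeq]; ring

/-- The terms `i α₂ W_k` from the row and from the exponential cancel, so that the dark sequence
obeys the same recursion as the bright one. -/
lemma hasDerivAt_darkSeq_x (hp : ∀ i j, p i + conj (p j) ≠ 0)
    (hf : tauF ε₁ ε₂ ρ₂ α₂ p ξ₀ C x t ≠ 0) (k : ℕ) :
    HasDerivAt (fun y => darkSeq ε₁ ε₂ ρ₂ α₂ p ξ₀ C k y t)
      (darkSeq ε₁ ε₂ ρ₂ α₂ p ξ₀ C (k + 1) x t
        - darkSeq ε₁ ε₂ ρ₂ α₂ p ξ₀ C 0 x t * potT ε₁ ε₂ ρ₂ α₂ p ξ₀ C 0 k x t) x := by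
  refine (((hasDerivAt_potW_x ε₁ ε₂ ρ₂ α₂ hp hf k).const_sub _).mul
    ((hasDerivAt_darkExp_x ε₂ ρ₂ α₂).const_mul (ρ₂ : ℂ))).congr_deriv ?_
  simp only [darkSeq]; ring

lemma hasDerivAt_brightSeq_t (hp : ∀ i j, p i + conj (p j) ≠ 0)
    (hf : tauF ε₁ ε₂ ρ₂ α₂ p ξ₀ C x t ≠ 0) (Y : ℕ → ℂ)
    (hY : ∀ k, Y k = brightSeq ε₁ ε₂ ρ₂ α₂ p ξ₀ C k x t) :
    HasDerivAt (fun s => brightSeq ε₁ ε₂ ρ₂ α₂ p ξ₀ C 0 x s)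
      (Y 3 - 3 * ((ε₂ : ℂ) * (ρ₂ : ℂ) ^ 2) * Y 1
        - (Y 2 * potT ε₁ ε₂ ρ₂ α₂ p ξ₀ C 0 0 x t - Y 1 * potT ε₁ ε₂ ρ₂ α₂ p ξ₀ C 1 0 x t
          + Y 0 * potT ε₁ ε₂ ρ₂ α₂ p ξ₀ C 2 0 x t
          - 3 * ((ε₂ : ℂ) * (ρ₂ : ℂ) ^ 2) * (Y 0 * potT ε₁ ε₂ ρ₂ α₂ p ξ₀ C 0 0 x t))
        - 3 * ((ε₂ : ℂ) * (ρ₂ : ℂ) ^ 2) * (Complex.I * α₂) * Y 0) t := by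
  refine ((hasDerivAt_potR_t ε₁ ε₂ ρ₂ α₂ hp hf).mul
    (hasDerivAt_brightExp ε₂ ρ₂ α₂)).congr_deriv ?_
  simp only [hY, brightSeq]; ring

lemma hasDerivAt_darkSeq_t (hp : ∀ i j, p i + conj (p j) ≠ 0)
    (hf : tauF ε₁ ε₂ ρ₂ α₂ p ξ₀ C x t ≠ 0) (Y : ℕ → ℂ)
    (hY : ∀ k, Y k = darkSeq ε₁ ε₂ ρ₂ α₂ p ξ₀ C k x t) :
    HasDerivAt (fun s => darkSeq ε₁ ε₂ ρ₂ α₂ p ξ₀ C 0 x s)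
      (Y 3 - 3 * ((ε₂ : ℂ) * (ρ₂ : ℂ) ^ 2) * Y 1
        - (Y 2 * potT ε₁ ε₂ ρ₂ α₂ p ξ₀ C 0 0 x t - Y 1 * potT ε₁ ε₂ ρ₂ α₂ p ξ₀ C 1 0 x t
          + Y 0 * potT ε₁ ε₂ ρ₂ α₂ p ξ₀ C 2 0 x t
          - 3 * ((ε₂ : ℂ) * (ρ₂ : ℂ) ^ 2) * (Y 0 * potT ε₁ ε₂ ρ₂ α₂ p ξ₀ C 0 0 x t))
        - 3 * ((ε₂ : ℂ) * (ρ₂ : ℂ) ^ 2) * (Complex.I * α₂) * Y 0) t := by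
  refine (((hasDerivAt_potW_t ε₁ ε₂ ρ₂ α₂ hp hf).const_sub _).mul
    ((hasDerivAt_darkExp_t ε₂ ρ₂ α₂).const_mul (ρ₂ : ℂ))).congr_deriv ?_
  simp only [hY, darkSeq]
  generalize Complex.I * (α₂ : ℂ) = a
  ring

lemma bright_eq_seq : bright ε₁ ε₂ ρ₂ α₂ p ξ₀ C x t = brightSeq ε₁ ε₂ ρ₂ α₂ p ξ₀ C 0 x t :=
  bright_eq ε₁ ε₂ ρ₂ α₂

lemma dark_eq_seq (hp : ∀ i j, p i + conj (p j) ≠ 0) (hf : tauF ε₁ ε₂ ρ₂ α₂ p ξ₀ C x t ≠ 0) :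
    dark ε₁ ε₂ ρ₂ α₂ p ξ₀ C x t = darkSeq ε₁ ε₂ ρ₂ α₂ p ξ₀ C 0 x t := by
  rw [dark_eq ε₁ ε₂ ρ₂ α₂ hp hf, darkSeq, pow_zero]

/-- The two Sylvester identities expressed through `u₁`, `u₂` and their `x`-derivatives. -/
lemma intensity_and_current (hp : ∀ i j, p i + conj (p j) ≠ 0)
    (hq : ∀ i j, (ε₂ : ℂ) * (ρ₂ : ℂ) ^ 2
      / ((p i - Complex.I * (α₂ : ℂ)) * (conj (p j) + Complex.I * (α₂ : ℂ))) ≠ 1)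
    (hf : tauF ε₁ ε₂ ρ₂ α₂ p ξ₀ C x t ≠ 0) (T : ℕ → ℕ → ℂ)
    (hT : ∀ j k, T j k = potT ε₁ ε₂ ρ₂ α₂ p ξ₀ C j k x t) :
    (ε₁ : ℂ) * (‖brightSeq ε₁ ε₂ ρ₂ α₂ p ξ₀ C 0 x t‖ : ℂ) ^ 2
        + (ε₂ : ℂ) * (‖darkSeq ε₁ ε₂ ρ₂ α₂ p ξ₀ C 0 x t‖ : ℂ) ^ 2
      = (ε₂ : ℂ) * (ρ₂ : ℂ) ^ 2 - (T 1 0 + T 0 1 - T 0 0 ^ 2) ∧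
    (ε₁ : ℂ) * conj (brightSeq ε₁ ε₂ ρ₂ α₂ p ξ₀ C 0 x t)
        * (brightSeq ε₁ ε₂ ρ₂ α₂ p ξ₀ C 1 x t - brightSeq ε₁ ε₂ ρ₂ α₂ p ξ₀ C 0 x t * T 0 0)
      + (ε₂ : ℂ) * conj (darkSeq ε₁ ε₂ ρ₂ α₂ p ξ₀ C 0 x t)
        * (darkSeq ε₁ ε₂ ρ₂ α₂ p ξ₀ C 1 x t - darkSeq ε₁ ε₂ ρ₂ α₂ p ξ₀ C 0 x t * T 0 0)
      = (ε₂ : ℂ) * (ρ₂ : ℂ) ^ 2 * (Complex.I * α₂) - T 0 2 - T 1 1 + 2 * T 0 0 * T 0 1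
        + T 0 0 * T 1 0 - T 0 0 ^ 3 := by
  have h1 := intensity_identity ε₁ ε₂ ρ₂ α₂ hp hq hf
  have h2 := current_identity ε₁ ε₂ ρ₂ α₂ hp hq hf
  have hb := mul_conj_eq_one (norm_brightExp ε₂ ρ₂ α₂ (t := t))
  have hd := mul_conj_eq_one (norm_darkExp ε₂ ρ₂ α₂ (x := x) (t := t))
  simp only [← hT] at h1 h2
  simp only [← Complex.mul_conj']
  simp only [brightSeq, darkSeq, map_mul, map_sub, map_one, pow_zero, pow_one,
    Complex.conj_ofReal]
  generalize potR ε₁ ε₂ ρ₂ α₂ p ξ₀ C 0 x t = R0 at *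
  generalize potR ε₁ ε₂ ρ₂ α₂ p ξ₀ C 1 x t = R1 at *
  generalize potW ε₁ ε₂ ρ₂ α₂ p ξ₀ C 0 x t = W0 at *
  generalize potW ε₁ ε₂ ρ₂ α₂ p ξ₀ C 1 x t = W1 at *
  constructor
  · rw [← h1]
    linear_combination (ε₁ : ℂ) * R0 * conj R0 * hb
      + (ε₂ : ℂ) * (ρ₂ : ℂ) ^ 2 * (1 - W0) * (1 - conj W0) * hd
  · rw [← h2]
    linear_combination (ε₁ : ℂ) * conj R0 * (R1 - T 0 0 * R0) * hb
      + (ε₂ : ℂ) * (ρ₂ : ℂ) ^ 2 * (1 - conj W0)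
        * (Complex.I * α₂ - T 0 0 - W1 + T 0 0 * W0) * hd

theorem isSolutionOn (hp : ∀ i j, p i + conj (p j) ≠ 0)
    (hq : ∀ i j, (ε₂ : ℂ) * (ρ₂ : ℂ) ^ 2
      / ((p i - Complex.I * (α₂ : ℂ)) * (conj (p j) + Complex.I * (α₂ : ℂ))) ≠ 1) :
    IsSolutionOn ε₁ ε₂ {z : ℝ × ℝ | tauF ε₁ ε₂ ρ₂ α₂ p ξ₀ C z.1 z.2 ≠ 0}
        (bright ε₁ ε₂ ρ₂ α₂ p ξ₀ C) (dark ε₁ ε₂ ρ₂ α₂ p ξ₀ C) := by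
  have h1 : ContDiff ℝ ∞ fun z : ℝ × ℝ => (z.1 : ℂ) := Complex.ofRealCLM.contDiff.comp contDiff_fst
  have h2 : ContDiff ℝ ∞ fun z : ℝ × ℝ => (z.2 : ℂ) := Complex.ofRealCLM.contDiff.comp contDiff_snd
  have hF := ((contDiff_tauF ε₁ ε₂ ρ₂ α₂ p ξ₀ C).contDiffOn
    (s := {z : ℝ × ℝ | tauF ε₁ ε₂ ρ₂ α₂ p ξ₀ C z.1 z.2 ≠ 0})).inv fun z hz => hz
  have hbr : bright ε₁ ε₂ ρ₂ α₂ p ξ₀ C = brightSeq ε₁ ε₂ ρ₂ α₂ p ξ₀ C 0 := by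
    funext x t; exact bright_eq_seq ε₁ ε₂ ρ₂ α₂
  have hdx : ∀ {x t}, tauF ε₁ ε₂ ρ₂ α₂ p ξ₀ C x t ≠ 0 →
      (fun y => dark ε₁ ε₂ ρ₂ α₂ p ξ₀ C y t)
        =ᶠ[𝓝 x] fun y => darkSeq ε₁ ε₂ ρ₂ α₂ p ξ₀ C 0 y t := fun hf =>
    (eventually_tauF_x ε₁ ε₂ ρ₂ α₂ hf).mono fun y hy => dark_eq_seq ε₁ ε₂ ρ₂ α₂ hp hy
  have hdt : ∀ {x t}, tauF ε₁ ε₂ ρ₂ α₂ p ξ₀ C x t ≠ 0 →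
      (fun s => dark ε₁ ε₂ ρ₂ α₂ p ξ₀ C x s)
        =ᶠ[𝓝 t] fun s => darkSeq ε₁ ε₂ ρ₂ α₂ p ξ₀ C 0 x s := fun hf =>
    (eventually_tauF_t ε₁ ε₂ ρ₂ α₂ hf).mono fun s hs => dark_eq_seq ε₁ ε₂ ρ₂ α₂ hp hs
  have hTx : ∀ {x t}, tauF ε₁ ε₂ ρ₂ α₂ p ξ₀ C x t ≠ 0 → ∀ᶠ y in 𝓝 x, ∀ j k,
      HasDerivAt (fun y => potT ε₁ ε₂ ρ₂ α₂ p ξ₀ C j k y t)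
      (potT ε₁ ε₂ ρ₂ α₂ p ξ₀ C (j + 1) k y t + potT ε₁ ε₂ ρ₂ α₂ p ξ₀ C j (k + 1) y t
        - potT ε₁ ε₂ ρ₂ α₂ p ξ₀ C j 0 y t * potT ε₁ ε₂ ρ₂ α₂ p ξ₀ C 0 k y t) y := fun hf =>
    (eventually_tauF_x ε₁ ε₂ ρ₂ α₂ hf).mono fun y hy => hasDerivAt_potT_x ε₁ ε₂ ρ₂ α₂ hp hy
  have hB : ∀ {x t}, tauF ε₁ ε₂ ρ₂ α₂ p ξ₀ C x t ≠ 0 → _ := fun {x t} hf =>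
    derivs_of_recursion (T := fun j k y => potT ε₁ ε₂ ρ₂ α₂ p ξ₀ C j k y t)
      (Y := fun k y => brightSeq ε₁ ε₂ ρ₂ α₂ p ξ₀ C k y t) (hTx hf)
      ((eventually_tauF_x ε₁ ε₂ ρ₂ α₂ hf).mono fun y hy =>
        hasDerivAt_brightSeq_x ε₁ ε₂ ρ₂ α₂ hp hy)
  have hD : ∀ {x t}, tauF ε₁ ε₂ ρ₂ α₂ p ξ₀ C x t ≠ 0 → _ := fun {x t} hf =>
    derivs_of_recursion (T := fun j k y => potT ε₁ ε₂ ρ₂ α₂ p ξ₀ C j k y t)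
      (Y := fun k y => darkSeq ε₁ ε₂ ρ₂ α₂ p ξ₀ C k y t) (hTx hf)
      ((eventually_tauF_x ε₁ ε₂ ρ₂ α₂ hf).mono fun y hy =>
        hasDerivAt_darkSeq_x ε₁ ε₂ ρ₂ α₂ hp hy)
  refine ⟨isOpen_tauF_ne_zero ε₁ ε₂ ρ₂ α₂ p ξ₀ C, ?_, ?_, ?_, ?_⟩
  · simp only [bright, div_eq_mul_inv]
    refine (((contDiff_tauG ε₁ ε₂ ρ₂ α₂ p ξ₀ C).contDiffOn).mul hF).mul (ContDiff.contDiffOn ?_)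
    fun_prop
  · simp only [dark, div_eq_mul_inv]
    refine ((((contDiff_tauH ε₁ ε₂ ρ₂ α₂ p ξ₀ C).contDiffOn).mul hF).mul contDiffOn_const).mul
      (ContDiff.contDiffOn ?_)
    fun_prop
  · intro x t hf
    replace hf : tauF ε₁ ε₂ ρ₂ α₂ p ξ₀ C x t ≠ 0 := hf
    obtain ⟨hi, hc⟩ := intensity_and_current ε₁ ε₂ ρ₂ α₂ hp hq hf _ fun _ _ => rfl
    rw [rhs, hbr, (hdx hf).deriv_eq, dark_eq_seq ε₁ ε₂ ρ₂ α₂ hp hf, (hB hf).2, (hB hf).1,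
      (hD hf).1, (hasDerivAt_brightSeq_t ε₁ ε₂ ρ₂ α₂ hp hf _ fun _ => rfl).deriv, hi, hc]
    ring
  · intro x t hf
    replace hf : tauF ε₁ ε₂ ρ₂ α₂ p ξ₀ C x t ≠ 0 := hf
    obtain ⟨hi, hc⟩ := intensity_and_current ε₁ ε₂ ρ₂ α₂ hp hq hf _ fun _ _ => rfl
    rw [rhs, hbr, (hdx hf).deriv_eq, (hdx hf).iteratedDeriv_eq, dark_eq_seq ε₁ ε₂ ρ₂ α₂ hp hf,
      (hdt hf).deriv_eq, (hD hf).2, (hB hf).1,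
      (hD hf).1, (hasDerivAt_darkSeq_t ε₁ ε₂ ρ₂ α₂ hp hf _ fun _ => rfl).deriv, hi, hc]
    ring

end Solution

/-! ### Cauchy determinants and limits of Gram-type matrices -/

section Gram
variable {n : Type*} {ι : Type*} {l : Filter ι}

/-- The matrix with entries `c_{ij} a_i a_j^* + g_{ij} b_i^* b_j`. -/
noncomputable def gram (c g : Matrix n n ℂ) (a b : n → ℂ) : Matrix n n ℂ :=
  Matrix.of fun i j => c i j * (a i * conj (a j)) + g i j * (conj (b i) * b j)

lemma tendsto_gram (c g : Matrix n n ℂ) {a b : ι → n → ℂ} {a' b' : n → ℂ}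
    (ha : ∀ i, Filter.Tendsto (fun x => a x i) l (𝓝 (a' i)))
    (hb : ∀ i, Filter.Tendsto (fun x => b x i) l (𝓝 (b' i))) (i j : n) :
    Filter.Tendsto (fun x => gram c g (a x) (b x) i j) l (𝓝 (gram c g a' b' i j)) := by
  have hc : ∀ {u : ι → ℂ} {z : ℂ}, Filter.Tendsto u l (𝓝 z) →
      Filter.Tendsto (fun x => conj (u x)) l (𝓝 (conj z)) := fun h =>
    (Complex.continuous_conj.tendsto _).comp h
  exact (((ha i).mul (hc (ha j))).const_mul _).add (((hc (hb i)).mul (hb j)).const_mul _)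

/-- The matrix `gram c g a b` bordered by the column `a`, the row `-b` and the corner `0`. -/
noncomputable def borderedGram (c g : Matrix n n ℂ) (a b : n → ℂ) :
    Matrix (n ⊕ Unit) (n ⊕ Unit) ℂ :=
  Matrix.fromBlocks (gram c g a b) (Matrix.of fun i (_ : Unit) => a i)
    (Matrix.of fun (_ : Unit) j => -b j) 0

lemma tendsto_borderedGram (c g : Matrix n n ℂ) {a b : ι → n → ℂ} {a' b' : n → ℂ}
    (ha : ∀ i, Filter.Tendsto (fun x => a x i) l (𝓝 (a' i)))
    (hb : ∀ i, Filter.Tendsto (fun x => b x i) l (𝓝 (b' i))) (i j : n ⊕ Unit) :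
    Filter.Tendsto (fun x => borderedGram c g (a x) (b x) i j) l
      (𝓝 (borderedGram c g a' b' i j)) := by
  rcases i with i | i <;> rcases j with j | j
  · exact tendsto_gram c g ha hb i j
  · exact ha i
  · exact (hb j).neg
  · exact tendsto_const_nhds

variable [Fintype n] [DecidableEq n]

/-- A Cauchy matrix with distinct nodes is invertible: a kernel vector `v` would give the polynomial
`∑ⱼ vⱼ ∏_{k ≠ j} (X + yₖ)` of degree less than `n` with the `n` roots `xᵢ`. -/
lemma det_cauchy_ne_zero {x y : n → ℂ} (hx : Function.Injective x) (hy : Function.Injective y)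
    (hxy : ∀ i j, x i + y j ≠ 0) : (Matrix.of fun i j => (x i + y j)⁻¹).det ≠ 0 := by
  intro h0
  obtain ⟨v, hv, hMv⟩ := exists_mulVec_eq_zero_iff.2 h0
  apply hv
  let P : Polynomial ℂ := ∑ j, Polynomial.C (v j) *
    ∏ k ∈ Finset.univ.erase j, (Polynomial.X + Polynomial.C (y k))
  have hP : P = 0 := by
    refine Polynomial.eq_zero_of_degree_lt_of_eval_index_eq_zero Finset.univ hx.injOn ?_ ?_
    · rw [← Polynomial.mem_degreeLT]
      refine Submodule.sum_mem _ fun j _ => ?_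
      rw [← Polynomial.smul_eq_C_mul]
      refine Submodule.smul_mem _ _ ?_
      rw [Polynomial.mem_degreeLT, Polynomial.degree_prod]
      simp only [Polynomial.degree_X_add_C, Finset.sum_const, nsmul_eq_mul, mul_one]
      exact_mod_cast Finset.card_erase_lt_of_mem (Finset.mem_univ j)
    · intro i _
      have hi := congrFun hMv i
      simp only [mulVec, dotProduct, Matrix.of_apply, Pi.zero_apply] at hi
      rw [Polynomial.eval_finsetSum, ← mul_zero (∏ k, (x i + y k)), ← hi, Finset.mul_sum]
      refine Finset.sum_congr rfl fun j _ => ?_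
      rw [Polynomial.eval_mul, Polynomial.eval_C, Polynomial.eval_prod,
        ← Finset.mul_prod_erase _ _ (Finset.mem_univ j)]
      simp only [Polynomial.eval_add, Polynomial.eval_X, Polynomial.eval_C]
      have := hxy i j
      field_simp
  funext j
  have hj := congrArg (Polynomial.eval (-y j)) hP
  rw [Polynomial.eval_finsetSum, Polynomial.eval_zero, Finset.sum_eq_single j] at hj
  · rw [Polynomial.eval_mul, Polynomial.eval_C, Polynomial.eval_prod] at hj
    refine (mul_eq_zero.1 hj).resolve_right (Finset.prod_ne_zero_iff.2 fun k hk => ?_)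
    simp only [Polynomial.eval_add, Polynomial.eval_X, Polynomial.eval_C]
    intro h
    exact (Finset.ne_of_mem_erase hk) (hy (by linear_combination h))
  · intro k _ hkj
    rw [Polynomial.eval_mul, Polynomial.eval_prod,
      Finset.prod_eq_zero (Finset.mem_erase.2 ⟨hkj.symm, Finset.mem_univ j⟩) (by simp), mul_zero]
  · simp

lemma gram_scale (c g : Matrix n n ℂ) (s a b : n → ℂ) :
    gram c g (s * a) (star s * b) = diagonal s * gram c g a b * diagonal (star s) := by
  ext i j
  simp only [gram, Matrix.of_apply, mul_diagonal, diagonal_mul, Pi.mul_apply, Pi.star_apply]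
  simp only [← starRingEnd_apply, map_mul, Complex.conj_conj]
  ring

lemma det_gram_scale (c g : Matrix n n ℂ) (s a b : n → ℂ) :
    (gram c g (s * a) (star s * b)).det = ((∏ i, s i) * ∏ i, star s i) * (gram c g a b).det := by
  rw [gram_scale, det_mul, det_mul, det_diagonal, det_diagonal]
  ring

lemma det_borderedGram_scale (c g : Matrix n n ℂ) (s a b : n → ℂ) :
    (borderedGram c g (s * a) (star s * b)).det
      = ((∏ i, s i) * ∏ i, star s i) * (borderedGram c g a b).det := by
  have h : borderedGram c g (s * a) (star s * b) =
      Matrix.fromBlocks (diagonal s) 0 0 1 * borderedGram c g a b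
        * Matrix.fromBlocks (diagonal (star s)) 0 0 (1 : Matrix Unit Unit ℂ) := by
    simp only [borderedGram, fromBlocks_multiply, gram_scale, Matrix.zero_mul, Matrix.mul_zero,
      add_zero, zero_add, Matrix.one_mul, Matrix.mul_one]
    congr 1
    · ext i j; simp [diagonal_mul]
    · ext i j; simp [mul_diagonal, mul_comm]
  rw [h, det_mul, det_mul, det_fromBlocks_zero₁₂, det_fromBlocks_zero₁₂, det_one, det_diagonal,
    det_diagonal]
  ring

/-- For `a` and `b` with disjoint supports the bordered determinant vanishes: let `s` be `+1` on the
support of `a` and `-1` elsewhere; multiplying by `diag (s, -1)` from the left and by `diag (s, 1)`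
from the right preserves the matrix and negates the determinant. -/
lemma det_borderedGram_eq_zero (c g : Matrix n n ℂ) {a b : n → ℂ} (hab : ∀ i, a i = 0 ∨ b i = 0) :
    (borderedGram c g a b).det = 0 := by
  let s : n → ℂ := fun i => if a i = 0 then -1 else 1
  have hs : ∀ i, s i * s i = 1 := fun i => by by_cases h : a i = 0 <;> simp [s, h]
  have hsa : ∀ i, s i * a i = a i := fun i => by by_cases h : a i = 0 <;> simp [s, h]
  have hsb : ∀ i, s i * b i = -b i := fun i => by
    by_cases h : a i = 0
    · simp [s, h]
    · simp [s, (hab i).resolve_left h]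
  have hsac : ∀ i, s i * conj (a i) = conj (a i) := fun i => by
    by_cases h : a i = 0 <;> simp [s, h]
  have hsbc : ∀ i, s i * conj (b i) = -conj (b i) := fun i => by
    by_cases h : a i = 0
    · simp [s, h]
    · simp [s, (hab i).resolve_left h]
  have h : borderedGram c g a b =
      Matrix.fromBlocks (diagonal s) 0 0 (-1) * borderedGram c g a b
        * Matrix.fromBlocks (diagonal s) 0 0 (1 : Matrix Unit Unit ℂ) := by
    simp only [borderedGram, fromBlocks_multiply, Matrix.zero_mul, Matrix.mul_zero,
      add_zero, zero_add, Matrix.mul_one]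
    congr 1
    · ext i j
      simp only [gram, Matrix.of_apply, mul_diagonal, diagonal_mul]
      linear_combination (-c i j * conj (a j)) * hsa i - (c i j * s i * a i) * hsac j
        + g i j * b j * hsbc i - g i j * s i * conj (b i) * hsb j
    · ext i j; simp [diagonal_mul, hsa]
    · ext i j; simp [mul_diagonal, mul_comm (b j), hsb]
  have hdet := congrArg Matrix.det h
  rw [det_mul, det_mul, det_fromBlocks_zero₁₂, det_fromBlocks_zero₁₂, det_one, det_diagonal,
    det_neg, det_one] at hdet
  have hsq : (∏ i, s i) * ∏ i, s i = 1 := by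
    rw [← Finset.prod_mul_distrib]
    exact Finset.prod_eq_one fun i _ => hs i
  simp only [Fintype.card_unit, pow_one, mul_one] at hdet
  linear_combination (1 / 2 : ℂ) * hdet - (1 / 2 : ℂ) * (borderedGram c g a b).det * hsq

lemma tendsto_det {M : ι → Matrix n n ℂ} {L : Matrix n n ℂ}
    (h : ∀ i j, Filter.Tendsto (fun x => M x i j) l (𝓝 (L i j))) :
    Filter.Tendsto (fun x => (M x).det) l (𝓝 L.det) :=
  ((continuous_id.matrix_det (A := fun M : Matrix n n ℂ => M)).tendsto L).comp
    (tendsto_pi_nhds.2 fun i => tendsto_pi_nhds.2 fun j => h i j)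

/-- Where `a` is the indicator of `S` and `b` is supported off `S`, `gram` is block diagonal; it is
invertible as soon as both blocks are Cauchy matrices with distinct nodes. -/
lemma det_gram_ne_zero {x y lam mu : n → ℂ} {ε : ℂ} (hε : ε ≠ 0) {S : n → Prop} [DecidablePred S]
    {b : n → ℂ} (hb : ∀ i, S i → b i = 0) (hb' : ∀ i, ¬ S i → b i ≠ 0)
    (hx : Function.Injective x) (hy : Function.Injective y) (hxy : ∀ i j, x i + y j ≠ 0)
    (hlam : ∀ i j, ¬ S i → ¬ S j → lam i = lam j → i = j)
    (hmu : ∀ i j, ¬ S i → ¬ S j → mu i = mu j → i = j) (hlm : ∀ i j, lam i + mu j ≠ 0) :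
    (gram (Matrix.of fun i j => (x i + y j)⁻¹) (Matrix.of fun i j => ε * (lam i + mu j)⁻¹)
      (fun i => if S i then 1 else 0) b).det ≠ 0 := by
  rw [twoBlockTriangular_det _ S fun i hi j hj => by simp [gram, hi, hb j hj]]
  refine mul_ne_zero ?_ ?_
  · have h := det_cauchy_ne_zero (x := fun i : {i // S i} => x i) (y := fun i : {i // S i} => y i)
      (hx.comp Subtype.val_injective) (hy.comp Subtype.val_injective) fun i j => hxy i j
    convert h using 2
    ext i j
    simp [toSquareBlockProp, gram, i.2, j.2, hb]
  · have h := det_cauchy_ne_zero (x := fun i : {i // ¬ S i} => lam i)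
      (y := fun i : {i // ¬ S i} => mu i)
      (fun i j hij => Subtype.ext (hlam i j i.2 j.2 hij))
      (fun i j hij => Subtype.ext (hmu i j i.2 j.2 hij)) fun i j => hlm i j
    have hblock : toSquareBlockProp (gram (Matrix.of fun i j => (x i + y j)⁻¹)
        (Matrix.of fun i j => ε * (lam i + mu j)⁻¹) (fun i => if S i then 1 else 0) b)
          (fun i => ¬ S i)
        = diagonal (fun i : {i // ¬ S i} => ε * conj (b i))
          * (Matrix.of fun i j : {i // ¬ S i} => (lam i + mu j)⁻¹)
          * diagonal (fun i : {i // ¬ S i} => b i) := by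
      ext i j
      simp only [toSquareBlockProp, gram, Matrix.of_apply, mul_diagonal, diagonal_mul, if_neg i.2,
        zero_mul, mul_zero, zero_add, toBlock_apply]
      ring
    rw [hblock, det_mul, det_mul, det_diagonal, det_diagonal]
    refine mul_ne_zero (mul_ne_zero (Finset.prod_ne_zero_iff.2 fun i _ => ?_) h)
      (Finset.prod_ne_zero_iff.2 fun i _ => hb' i i.2)
    exact mul_ne_zero hε ((map_ne_zero _).2 (hb' i i.2))

end Gram

/-! ### Boundary behaviour -/

section Boundary
variable {N : ℕ} (ε₁ ε₂ ρ₂ α₂ : ℝ) (p ξ₀ C : Fin N → ℂ)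

/-- The coefficients of the exponential part of `M_k`. -/
noncomputable def expCoeff (k : ℤ) : Matrix (Fin N) (Fin N) ℂ :=
  Matrix.of fun i j => 1 / (p i + conj (p j))
    * (-((p i - Complex.I * (α₂ : ℂ)) / (conj (p j) + Complex.I * (α₂ : ℂ)))) ^ k

/-- The coefficients of the constant part of `M_k`. -/
noncomputable def constCoeff : Matrix (Fin N) (Fin N) ℂ :=
  Matrix.of fun i j => (ε₁ : ℂ) / ((p i + conj (p j))
    * ((ε₂ : ℂ) * (ρ₂ : ℂ) ^ 2
        / ((p i - Complex.I * (α₂ : ℂ)) * (conj (p j) + Complex.I * (α₂ : ℂ))) - 1))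

lemma matM_eq_gram (k : ℤ) (x t : ℝ) : matM ε₁ ε₂ ρ₂ α₂ p ξ₀ C k x t
    = gram (expCoeff α₂ p k) (constCoeff ε₁ ε₂ ρ₂ α₂ p) (col ε₂ ρ₂ p ξ₀ 0 x t) C := by
  ext i j
  simp only [matM, gram, expCoeff, constCoeff, col, Matrix.of_apply, Complex.exp_add,
    ← Complex.exp_conj, pow_zero, one_mul]
  ring

lemma tauG_eq (x t : ℝ) : tauG ε₁ ε₂ ρ₂ α₂ p ξ₀ C x t
    = (borderedGram (expCoeff α₂ p 0) (constCoeff ε₁ ε₂ ρ₂ α₂ p)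
        (col ε₂ ρ₂ p ξ₀ 0 x t) C).det := by
  rw [tauG, borderedGram, matM_eq_gram]
  simp only [col, pow_zero, one_mul]

variable {p C}

/-- The second block of the limiting matrix is a Cauchy matrix as well, with the nodes
`κ / d - d` and their conjugates, where `d = p - i α₂` and `κ = ε₂ ρ₂²`. -/
lemma constCoeff_eq (hp : ∀ i j, p i + conj (p j) ≠ 0) : constCoeff ε₁ ε₂ ρ₂ α₂ p =
    Matrix.of fun i j => (ε₁ : ℂ) *
      (((ε₂ : ℂ) * (ρ₂ : ℂ) ^ 2 / (p i - Complex.I * α₂) - (p i - Complex.I * α₂))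
      + ((ε₂ : ℂ) * (ρ₂ : ℂ) ^ 2 / (conj (p j) + Complex.I * α₂)
        - (conj (p j) + Complex.I * α₂)))⁻¹ := by
  ext i j
  have hd := sub_ne_zero_of_add_conj α₂ hp i
  have he := conj_add_ne_zero α₂ hp j
  simp only [constCoeff, Matrix.of_apply, div_eq_mul_inv (ε₁ : ℂ)]
  congr 2
  have hsum : p i + conj (p j)
      = (p i - Complex.I * α₂) + (conj (p j) + Complex.I * α₂) := by ring
  rw [hsum]
  field_simp
  ring

lemma node_sum_ne_zero (hp : ∀ i j, p i + conj (p j) ≠ 0)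
    (hq : ∀ i j, (ε₂ : ℂ) * (ρ₂ : ℂ) ^ 2
      / ((p i - Complex.I * (α₂ : ℂ)) * (conj (p j) + Complex.I * (α₂ : ℂ))) ≠ 1) (i j : Fin N) :
    ((ε₂ : ℂ) * (ρ₂ : ℂ) ^ 2 / (p i - Complex.I * α₂) - (p i - Complex.I * α₂))
      + ((ε₂ : ℂ) * (ρ₂ : ℂ) ^ 2 / (conj (p j) + Complex.I * α₂)
        - (conj (p j) + Complex.I * α₂)) ≠ 0 := by
  have hd := sub_ne_zero_of_add_conj α₂ hp i
  have he := conj_add_ne_zero α₂ hp j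
  have h := mul_ne_zero (hp i j) (sub_ne_zero.2 (hq i j))
  convert h using 1
  have hsum : p i + conj (p j)
      = (p i - Complex.I * α₂) + (conj (p j) + Complex.I * α₂) := by ring
  rw [hsum]
  field_simp
  ring

lemma node_injective (hp : ∀ i j, p i + conj (p j) ≠ 0) (hinj : Function.Injective p)
    (hC : ∀ i j, i ≠ j → C i ≠ 0 → C j ≠ 0 →
      (p i - Complex.I * (α₂ : ℂ)) * (p j - Complex.I * (α₂ : ℂ)) ≠ -((ε₂ : ℂ) * (ρ₂ : ℂ) ^ 2))
    {i j : Fin N} (hi : C i ≠ 0) (hj : C j ≠ 0)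
    (h : (ε₂ : ℂ) * (ρ₂ : ℂ) ^ 2 / (p i - Complex.I * α₂) - (p i - Complex.I * α₂)
      = (ε₂ : ℂ) * (ρ₂ : ℂ) ^ 2 / (p j - Complex.I * α₂) - (p j - Complex.I * α₂)) : i = j := by
  by_contra hij
  have hdi := sub_ne_zero_of_add_conj α₂ hp i
  have hdj := sub_ne_zero_of_add_conj α₂ hp j
  have hne := hC i j hij hi hj
  have hpij : p i - Complex.I * α₂ ≠ p j - Complex.I * α₂ := fun h =>
    hij (hinj (sub_left_injective h))
  generalize p i - Complex.I * (α₂ : ℂ) = d at *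
  generalize p j - Complex.I * (α₂ : ℂ) = d' at *
  generalize (ε₂ : ℂ) * (ρ₂ : ℂ) ^ 2 = κ at *
  field_simp at h
  have h2 : (d - d') * (d * d' + κ) = 0 := by linear_combination -h
  rcases mul_eq_zero.1 h2 with h3 | h3
  · exact hpij (sub_eq_zero.1 h3)
  · exact hne (eq_neg_of_add_eq_zero_left h3)

/-- On the limiting block diagonal matrices, passing from `k = 0` to `k = 1` multiplies the rows and
columns of the exponential block by `-dᵢ` and `1 / dⱼ^*`, whose moduli cancel. -/
lemma norm_det_gram_one (hp : ∀ i j, p i + conj (p j) ≠ 0) (g : Matrix (Fin N) (Fin N) ℂ)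
    {S : Fin N → Prop} [DecidablePred S] {b : Fin N → ℂ} (hb : ∀ i, S i → b i = 0) :
    ‖(gram (expCoeff α₂ p 1) g (fun i => if S i then 1 else 0) b).det‖
      = ‖(gram (expCoeff α₂ p 0) g (fun i => if S i then 1 else 0) b).det‖ := by
  have h : gram (expCoeff α₂ p 1) g (fun i => if S i then 1 else 0) b
      = diagonal (fun i => if S i then -(p i - Complex.I * α₂) else 1)
        * gram (expCoeff α₂ p 0) g (fun i => if S i then 1 else 0) b
        * diagonal (fun i => if S i then (conj (p i) + Complex.I * α₂)⁻¹ else 1) := by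
    ext i j
    by_cases hi : S i <;> by_cases hj : S j <;>
      simp [gram, expCoeff, hi, hj, hb]
    ring
  rw [h, det_mul, det_mul, det_diagonal, det_diagonal, norm_mul, norm_mul, mul_right_comm,
    ← norm_mul, ← Finset.prod_mul_distrib, norm_prod, Finset.prod_eq_one, one_mul]
  intro i _
  by_cases hi : S i
  · have hd := sub_ne_zero_of_add_conj α₂ hp i
    simp only [if_pos hi, norm_mul, norm_neg, norm_inv, ← conj_sub_I_mul, RCLike.norm_conj]
    exact mul_inv_cancel₀ (norm_ne_zero_iff.2 hd)
  · simp [hi]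

/-- The boundary behaviour along a filter for which every exponential `e^{ξᵢ}` with `Cᵢ ≠ 0` either
vanishes or blows up. The rows and columns with `Cᵢ = 0` are always proportional to `e^{ξᵢ}` and
`e^{ξᵢ^*}` and are treated like those blowing up. -/
lemma tendsto_bright_dark {l : Filter ℝ} {t : ℝ} (hp : ∀ i j, p i + conj (p j) ≠ 0)
    (hq : ∀ i j, (ε₂ : ℂ) * (ρ₂ : ℂ) ^ 2
      / ((p i - Complex.I * (α₂ : ℂ)) * (conj (p j) + Complex.I * (α₂ : ℂ))) ≠ 1)
    (hε : ε₁ ≠ 0) (hinj : Function.Injective p)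
    (hC : ∀ i j, i ≠ j → C i ≠ 0 → C j ≠ 0 →
      (p i - Complex.I * (α₂ : ℂ)) * (p j - Complex.I * (α₂ : ℂ)) ≠ -((ε₂ : ℂ) * (ρ₂ : ℂ) ^ 2))
    (hl : ∀ i, Filter.Tendsto (fun x => col ε₂ ρ₂ p ξ₀ 0 x t i) l (𝓝 0)
      ∨ Filter.Tendsto (fun x => (col ε₂ ρ₂ p ξ₀ 0 x t i)⁻¹) l (𝓝 0)) :
    Filter.Tendsto (fun x => bright ε₁ ε₂ ρ₂ α₂ p ξ₀ C x t) l (𝓝 0) ∧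
    Filter.Tendsto (fun x => ‖dark ε₁ ε₂ ρ₂ α₂ p ξ₀ C x t‖) l (𝓝 |ρ₂|) := by
  classical
  let S : Fin N → Prop := fun i =>
    C i = 0 ∨ Filter.Tendsto (fun x => (col ε₂ ρ₂ p ξ₀ 0 x t i)⁻¹) l (𝓝 0)
  have hS : ∀ i, ¬ S i → C i ≠ 0 ∧ Filter.Tendsto (fun x => col ε₂ ρ₂ p ξ₀ 0 x t i) l (𝓝 0) :=
    fun i hi => ⟨fun h => hi (Or.inl h), (hl i).resolve_right fun h => hi (Or.inr h)⟩
  have hE : ∀ x i, col ε₂ ρ₂ p ξ₀ 0 x t i ≠ 0 := fun x i => by simp [col]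
  -- `col 0 = s * a` and `C = star s * b`, where `a → a'` and `b → b'` with disjoint supports.
  let s : ℝ → Fin N → ℂ := fun x i => if S i then col ε₂ ρ₂ p ξ₀ 0 x t i else 1
  let a : ℝ → Fin N → ℂ := fun x i => if S i then 1 else col ε₂ ρ₂ p ξ₀ 0 x t i
  let b : ℝ → Fin N → ℂ := fun x i =>
    if S i then C i * conj ((col ε₂ ρ₂ p ξ₀ 0 x t i)⁻¹) else C i
  let a' : Fin N → ℂ := fun i => if S i then 1 else 0
  let b' : Fin N → ℂ := fun i => if S i then 0 else C i
  have hs0 : ∀ x, (∏ i, s x i) * ∏ i, star (s x) i ≠ 0 := fun x => by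
    have hsi : ∀ i, s x i ≠ 0 := fun i => by
      by_cases hi : S i <;> simp [s, hi, hE]
    exact mul_ne_zero (Finset.prod_ne_zero_iff.2 fun i _ => hsi i)
      (Finset.prod_ne_zero_iff.2 fun i _ => star_ne_zero.2 (hsi i))
  have hsa : ∀ x, col ε₂ ρ₂ p ξ₀ 0 x t = s x * a x := fun x => by
    ext i; by_cases hi : S i <;> simp [s, a, hi]
  have hsb : ∀ x, C = star (s x) * b x := fun x => by
    ext i
    have h1 : conj (col ε₂ ρ₂ p ξ₀ 0 x t i) ≠ 0 := (map_ne_zero _).2 (hE x i)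
    by_cases hi : S i
    · simp only [s, b, hi, Pi.mul_apply, Pi.star_apply, if_true]
      simp only [← starRingEnd_apply, map_inv₀]
      field_simp
    · simp [s, b, hi]
  have ha : ∀ i, Filter.Tendsto (fun x => a x i) l (𝓝 (a' i)) := fun i => by
    by_cases hi : S i
    · simp only [a, a', hi, if_true]; exact tendsto_const_nhds
    · simp only [a, a', hi, if_false]; exact (hS i hi).2
  have hb : ∀ i, Filter.Tendsto (fun x => b x i) l (𝓝 (b' i)) := fun i => by
    by_cases hi : S i
    · simp only [b, b', hi, if_true]
      rcases hi with h | h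
      · simpa [h] using tendsto_const_nhds
      · simpa using ((Complex.continuous_conj.tendsto _).comp h).const_mul (C i)
    · simp only [b, b', hi, if_false]; exact tendsto_const_nhds
  have hdet : ∀ k x, (matM ε₁ ε₂ ρ₂ α₂ p ξ₀ C k x t).det = ((∏ i, s x i) * ∏ i, star (s x) i)
      * (gram (expCoeff α₂ p k) (constCoeff ε₁ ε₂ ρ₂ α₂ p) (a x) (b x)).det := fun k x => by
    rw [matM_eq_gram, ← det_gram_scale, ← hsa, ← hsb]
  have hlim : ∀ k, Filter.Tendsto (fun x =>
      (gram (expCoeff α₂ p k) (constCoeff ε₁ ε₂ ρ₂ α₂ p) (a x) (b x)).det) l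
      (𝓝 (gram (expCoeff α₂ p k) (constCoeff ε₁ ε₂ ρ₂ α₂ p) a' b').det) := fun k =>
    tendsto_det (tendsto_gram _ _ ha hb)
  have hb0 : ∀ i, S i → b' i = 0 := fun i hi => by simp [b', hi]
  have hne : (gram (expCoeff α₂ p 0) (constCoeff ε₁ ε₂ ρ₂ α₂ p) a' b').det ≠ 0 := by
    have hcoeff : expCoeff α₂ p 0 = Matrix.of fun i j => (p i + conj (p j))⁻¹ := by
      ext i j; simp [expCoeff]
    rw [hcoeff, constCoeff_eq ε₁ ε₂ ρ₂ α₂ hp]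
    refine det_gram_ne_zero (y := fun j => conj (p j))
      (lam := fun i => (ε₂ : ℂ) * (ρ₂ : ℂ) ^ 2 / (p i - Complex.I * α₂) - (p i - Complex.I * α₂))
      (mu := fun j => (ε₂ : ℂ) * (ρ₂ : ℂ) ^ 2 / (conj (p j) + Complex.I * α₂)
        - (conj (p j) + Complex.I * α₂)) (Complex.ofReal_ne_zero.2 hε) hb0
      (fun i hi => by simpa [b', hi] using (hS i hi).1) hinj
      ((starRingEnd ℂ).injective.comp hinj) hp
      (fun i j hi hj h => node_injective ε₂ ρ₂ α₂ hp hinj hC (hS i hi).1 (hS j hj).1 h)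
      (fun i j hi hj h => ?_) (node_sum_ne_zero ε₂ ρ₂ α₂ hp hq)
    refine node_injective ε₂ ρ₂ α₂ hp hinj hC (hS i hi).1 (hS j hj).1
      ((starRingEnd ℂ).injective ?_)
    simpa [sub_eq_add_neg] using h
  constructor
  · have hbord : Filter.Tendsto (fun x => (borderedGram (expCoeff α₂ p 0)
        (constCoeff ε₁ ε₂ ρ₂ α₂ p) (a x) (b x)).det) l (𝓝 0) := by
      rw [← det_borderedGram_eq_zero (expCoeff α₂ p 0) (constCoeff ε₁ ε₂ ρ₂ α₂ p)
        (a := a') (b := b') fun i => by by_cases hi : S i <;> simp [a', b', hi]]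
      exact tendsto_det (tendsto_borderedGram _ _ ha hb)
    have h := ((hbord.div (hlim 0) hne).mul_const
      (Complex.exp (-3 * Complex.I * (ρ₂ : ℂ) ^ 2 * (ε₂ : ℂ) * (α₂ : ℂ) * (t : ℂ))))
    rw [zero_div, zero_mul] at h
    refine h.congr fun x => ?_
    have hbdet := det_borderedGram_scale (expCoeff α₂ p 0) (constCoeff ε₁ ε₂ ρ₂ α₂ p)
      (s x) (a x) (b x)
    rw [← hsa, ← hsb] at hbdet
    rw [bright, tauG_eq, tauF, hdet, hbdet, mul_div_mul_left _ _ (hs0 x)]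
    rfl
  · have h := ((hlim 1).div (hlim 0) hne).norm.mul_const |ρ₂|
    rw [norm_div, norm_det_gram_one α₂ hp _ hb0, div_self (norm_ne_zero_iff.2 hne), one_mul] at h
    refine h.congr fun x => ?_
    have hexp := norm_darkExp ε₂ ρ₂ α₂ (x := x) (t := t)
    rw [darkExp] at hexp
    rw [dark, tauH, tauF, hdet, hdet, mul_div_mul_left _ _ (hs0 x), norm_mul, norm_mul, hexp,
      Complex.norm_real, Real.norm_eq_abs, mul_one]
    rfl

/-- The real part of `pᵢ` does not vanish, so each exponential decays at one end of the line and
blows up at the other. -/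
lemma tendsto_col_or_inv {l : Filter ℝ} {t : ℝ} (hp : ∀ i j, p i + conj (p j) ≠ 0)
    (hl : ∀ r : ℝ, r ≠ 0 → Filter.Tendsto (fun x => r * x) l Filter.atBot
      ∨ Filter.Tendsto (fun x => -r * x) l Filter.atBot) (i : Fin N) :
    Filter.Tendsto (fun x => col ε₂ ρ₂ p ξ₀ 0 x t i) l (𝓝 0)
      ∨ Filter.Tendsto (fun x => (col ε₂ ρ₂ p ξ₀ 0 x t i)⁻¹) l (𝓝 0) := by
  have hre : (p i).re ≠ 0 := fun h => hp i i (by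
    rw [Complex.add_conj, h]; simp)
  obtain ⟨c, hphase⟩ : ∃ c : ℝ, ∀ x, (phase ε₂ ρ₂ p ξ₀ x t i).re = (p i).re * x + c := by
    refine ⟨(phase ε₂ ρ₂ p ξ₀ 0 t i).re, fun x => ?_⟩
    have : phase ε₂ ρ₂ p ξ₀ x t i = p i * (x : ℂ) + phase ε₂ ρ₂ p ξ₀ 0 t i := by
      simp only [phase, Complex.ofReal_zero]; ring
    rw [this, Complex.add_re, Complex.re_mul_ofReal]
  simp only [col, pow_zero, one_mul, ← Complex.exp_neg, Complex.tendsto_exp_nhds_zero_iff,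
    Complex.neg_re, hphase]
  refine (hl _ hre).imp (fun h => Filter.tendsto_atBot_add_const_right _ _ h) fun h => ?_
  simp only [neg_add, ← neg_mul]
  exact Filter.tendsto_atBot_add_const_right _ _ h

theorem mixedBoundary (hp : ∀ i j, p i + conj (p j) ≠ 0)
    (hq : ∀ i j, (ε₂ : ℂ) * (ρ₂ : ℂ) ^ 2
      / ((p i - Complex.I * (α₂ : ℂ)) * (conj (p j) + Complex.I * (α₂ : ℂ))) ≠ 1)
    (hε : ε₁ ≠ 0) (hinj : Function.Injective p)
    (hC : ∀ i j, i ≠ j → C i ≠ 0 → C j ≠ 0 →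
      (p i - Complex.I * (α₂ : ℂ)) * (p j - Complex.I * (α₂ : ℂ)) ≠ -((ε₂ : ℂ) * (ρ₂ : ℂ) ^ 2)) :
    MixedBoundary ρ₂ (bright ε₁ ε₂ ρ₂ α₂ p ξ₀ C) (dark ε₁ ε₂ ρ₂ α₂ p ξ₀ C) := by
  intro t
  have htop := tendsto_bright_dark ε₁ ε₂ ρ₂ α₂ ξ₀ (l := Filter.atTop) (t := t) hp hq hε hinj hC
    (tendsto_col_or_inv ε₂ ρ₂ ξ₀ hp fun r hr => (lt_or_gt_of_ne hr).imp
      (fun h => Filter.tendsto_id.const_mul_atTop_of_neg h)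
      (fun h => Filter.tendsto_id.const_mul_atTop_of_neg (neg_lt_zero.2 h)))
  have hbot := tendsto_bright_dark ε₁ ε₂ ρ₂ α₂ ξ₀ (l := Filter.atBot) (t := t) hp hq hε hinj hC
    (tendsto_col_or_inv ε₂ ρ₂ ξ₀ hp fun r hr => (lt_or_gt_of_ne hr).symm.imp
      (fun h => Filter.tendsto_id.const_mul_atBot h)
      (fun h => Filter.tendsto_id.const_mul_atBot (neg_pos.2 h)))
  exact ⟨htop.1, hbot.1, htop.2, hbot.2⟩

end Boundary

end CoupledHirota

/-- The explicit bright-dark functions solve the coupled Hirota system wherever `f ≠ 0`; for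
nondegenerate parameters they satisfy the mixed boundary condition. -/
theorem theorem4p1 (N : ℕ) (ε₁ ε₂ ρ₂ α₂ : ℝ) (p ξ₀ C : Fin N → ℂ)
    (hp : ∀ i j, p i + conj (p j) ≠ 0)
    (hq : ∀ i j, (ε₂ : ℂ) * (ρ₂ : ℂ) ^ 2
      / ((p i - Complex.I * (α₂ : ℂ)) * (conj (p j) + Complex.I * (α₂ : ℂ))) ≠ 1) :
    CoupledHirota.IsSolutionOn ε₁ ε₂
        {z : ℝ × ℝ | CoupledHirota.tauF ε₁ ε₂ ρ₂ α₂ p ξ₀ C z.1 z.2 ≠ 0}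
        (CoupledHirota.bright ε₁ ε₂ ρ₂ α₂ p ξ₀ C) (CoupledHirota.dark ε₁ ε₂ ρ₂ α₂ p ξ₀ C) ∧
    (ε₁ ≠ 0 → Function.Injective p →
      (∀ i j, i ≠ j → C i ≠ 0 → C j ≠ 0 →
        (p i - Complex.I * (α₂ : ℂ)) * (p j - Complex.I * (α₂ : ℂ)) ≠ -((ε₂ : ℂ) * (ρ₂ : ℂ) ^ 2)) →
      CoupledHirota.MixedBoundary ρ₂
        (CoupledHirota.bright ε₁ ε₂ ρ₂ α₂ p ξ₀ C) (CoupledHirota.dark ε₁ ε₂ ρ₂ α₂ p ξ₀ C)) := by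
  exact ⟨CoupledHirota.isSolutionOn ε₁ ε₂ ρ₂ α₂ hp hq, fun hε hinj hC =>
    CoupledHirota.mixedBoundary ε₁ ε₂ ρ₂ α₂ ξ₀ hp hq hε hinj hC⟩
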